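/- Let $k$ be a field. A $k$-algebra (not necessarily associative or unital) is bicommutative if $x(yz)=y(xz)$ and $(xy)z=(xz)y$ for all $x,y,z$. Let $X=\{x_1,\dots,x_r\}$ be a set of $r>1$ letters and let $\mathrm{BC}(X)$ be the free bicommutative $k$-algebra on $X$. Let $[X]^+$ be the free commutative semigroup on $X$. For $u=z_1\cdots z_p$ and $v=y_1\cdots y_q$ in $[X]^+$ ($p,q\ge 1$) put $$[u;v]=z_1(z_2(\cdots(z_{p-1}((\cdots((z_py_1)y_2)\cdots)y_q))\cdots)).$$ The set $\mathrm{NF}(X)=X\cup\{[u;v]: u,v\in[X]^+\}$ is a linear basis of $\mathrm{BC}(X)$, with multiplication table $z\,y=[z;y]$, $z[u;v]=[zu;v]$, $[u;v]z=[u;vz]$, $[u;v][u';v']=[uu';vv']$ for $z,y\in X$. The length of a letter is $1$; the length of $[u;v]$ is the total number of letters of $u$ and $v$, counted with repetition. Fix any monomial order on $\mathrm{NF}(X)$, that is, a well order $<$ such that $\mu<\nu$ implies $\mu\rho<\nu\rho$ and $\rho\mu<\rho\nu$ for all $\rho\in\mathrm{NF}(X)$. For $0\neq f\in\mathrm{BC}(X)$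 let $\bar f$ be its leading (largest) monomial; $f$ is monic if the coefficient of $\bar f$ is $1$. Let $S\subseteq\mathrm{BC}(X)$ be a set of monic elements, let $\mathrm{Id}(S)$ be the two-sided ideal generated by $S$, and put $\mathrm{BC}(X|S)=\mathrm{BC}(X)/\mathrm{Id}(S)$. A normal $S$-polynomial is an element $s\in S$, or, if $s\in S$ and $\bar s$ has length at least $2$, any product $z_1(\cdots(z_p((\cdots(s\,y_1)\cdots)y_q))\cdots)$ with $p,q\ge 0$ and $z_i,y_j\in X$. The set $S$ is a Gröbner–Shirshov basis for $\mathrm{BC}(X|S)$ if for every nonzero $f\in\mathrm{Id}(S)$ there is a normal $S$-polynomial $h$ with $\bar f=\bar h$. For a $k$-algebra $B$ and a subspace $V\subseteq B$ put $V^1=V$, $V^n=\sum_{i=1}^{n-1}V^iV^{n-i}$ for $n\ge 2$ (where $VW$ is the span of all products $vw$ with $v\in V$, $w\in W$), and $V^{\le n}=V^1+\cdots+V^n$. Define $$\mathrm{GKdim}\,B=\sup_V\limsup_{n\to\infty}\log_n\dim_k V^{\le n},$$ where $V$ runs over all finite-dimensional subspaces of $B$, and $\mathrm{GKdim}\,0=0$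 by convention. Let $S=\{f_1,\dots,f_t\}$ be a finite Gröbner–Shirshov basis for $\mathrm{BC}(X|S)$ with exactly $t$ elements. Then: (i) if $1\le t\le r$ and no leading monomial $\bar f_i$ is a letter, then $\mathrm{GKdim}\,\mathrm{BC}(X|S)\in\{2r-t,2r-t+1,\dots,2r-1\}$; (ii) if $t>r$, then $\mathrm{GKdim}\,\mathrm{BC}(X|S)\in\{0,1,\dots,2r-1\}$. -/

import Mathlib

noncomputable section

namespace Bicomm

/-! ### Bicommutative multiplications -/

/-- A multiplication is bicommutative if it satisfies
`x(yz) = y(xz)` (left commutativity) and `(xy)z = (xz)y` (right commutativity). -/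
structure IsBicommutative (M : Type*) [Mul M] : Prop where
  left_comm : ∀ x y z : M, x * (y * z) = y * (x * z)
  right_comm : ∀ x y z : M, (x * y) * z = (x * z) * y

/-! ### Normal forms -/

/-- The set `NF(X)` of normal forms: the letters `x ∈ X` and the monomials `[u; v]` where `u`, `v`
are nonempty commutative words in `X`, that is, elements of the free commutative semigroup
`[X]⁺`, represented here as nonzero multisets. -/
inductive NF (X : Type*) : Type _
  | letter (x : X) : NF X
  | pair (u v : Multiset X) (hu : u ≠ 0) (hv : v ≠ 0) : NF X

namespace NF

variable {X : Type*}

/-- The length of a normal form, counted with repetition. -/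
def length : NF X → ℕ
  | letter _ => 1
  | pair u v _ _ => Multiset.card u + Multiset.card v

/-- The multiplication table of the normal forms:
`z y = [z; y]`, `z [u; v] = [z u; v]`, `[u; v] z = [u; v z]`, `[u; v] [u'; v'] = [u u'; v v']`. -/
def mul : NF X → NF X → NF X
  | letter z, letter y => pair {z} {y} (Multiset.singleton_ne_zero z) (Multiset.singleton_ne_zero y)
  | letter z, pair u v _ hv => pair (z ::ₘ u) v (Multiset.cons_ne_zero) hv
  | pair u v hu _, letter z => pair u (z ::ₘ v) hu (Multiset.cons_ne_zero)
  | pair u v hu hv, pair u' v' _ _ =>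
      pair (u + u') (v + v') (fun h => hu (add_eq_zero.1 h).1) (fun h => hv (add_eq_zero.1 h).1)

instance : Mul (NF X) := ⟨mul⟩

theorem letter_mul_letter (z y : X) : letter z * letter y =
    pair {z} {y} (Multiset.singleton_ne_zero z) (Multiset.singleton_ne_zero y) := rfl

theorem letter_mul_pair (z : X) (u v : Multiset X) (hu : u ≠ 0) (hv : v ≠ 0) :
    letter z * pair u v hu hv = pair (z ::ₘ u) v (Multiset.cons_ne_zero) hv := rfl

theorem pair_mul_letter (z : X) (u v : Multiset X) (hu : u ≠ 0) (hv : v ≠ 0) :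
    pair u v hu hv * letter z = pair u (z ::ₘ v) hu (Multiset.cons_ne_zero) := rfl

theorem pair_mul_pair (u v u' v' : Multiset X) (hu : u ≠ 0) (hv : v ≠ 0) (hu' : u' ≠ 0)
    (hv' : v' ≠ 0) : pair u v hu hv * pair u' v' hu' hv' =
      pair (u + u') (v + v') (fun h => hu (add_eq_zero.1 h).1)
        (fun h => hv (add_eq_zero.1 h).1) := rfl

theorem isBicommutative : IsBicommutative (NF X) where
  left_comm x y z := by
    cases x <;> cases y <;> cases z <;>
      simp only [letter_mul_letter, letter_mul_pair, pair_mul_letter, pair_mul_pair, pair.injEq,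
        ← Multiset.singleton_add] <;> constructor <;> first | trivial | ac_rfl
  right_comm x y z := by
    cases x <;> cases y <;> cases z <;>
      simp only [letter_mul_letter, letter_mul_pair, pair_mul_letter, pair_mul_pair, pair.injEq,
        ← Multiset.singleton_add] <;> constructor <;> first | trivial | ac_rfl

/-! ### The normal forms are the free bicommutative magma -/

section lift

variable {M : Type*} [Mul M]

theorem mid_assoc (hM : IsBicommutative M) (a b c d : M) :
    (a * (b * c)) * d = a * ((b * c) * d) := by
  rw [hM.left_comm a b c, hM.right_comm b (a * c) d, hM.left_comm (b * d) a c,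
    hM.right_comm b d c]

/-- Left multiplication by the letters of a word. -/
def mulL (hM : IsBicommutative M) (φ : X → M) (t : Multiset X) (b : M) : M :=
  haveI : LeftCommutative (fun (z : X) (b : M) => φ z * b) := ⟨fun _ _ _ => hM.left_comm _ _ _⟩
  t.foldr (fun z b => φ z * b) b

/-- Right multiplication by the letters of a word. -/
def mulR (hM : IsBicommutative M) (φ : X → M) (t : Multiset X) (b : M) : M :=
  haveI : LeftCommutative (fun (z : X) (b : M) => b * φ z) := ⟨fun _ _ _ => hM.right_comm _ _ _⟩
  t.foldr (fun z b => b * φ z) b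

variable (hM : IsBicommutative M) (φ : X → M)

theorem mulL_zero (b : M) : mulL hM φ 0 b = b := rfl

theorem mulR_zero (b : M) : mulR hM φ 0 b = b := rfl

theorem mulL_cons (z : X) (t : Multiset X) (b : M) :
    mulL hM φ (z ::ₘ t) b = φ z * mulL hM φ t b := by
  simp [mulL]

theorem mulR_cons (z : X) (t : Multiset X) (b : M) :
    mulR hM φ (z ::ₘ t) b = mulR hM φ t b * φ z := by
  simp [mulR]

theorem mulL_add (s t : Multiset X) (b : M) :
    mulL hM φ (s + t) b = mulL hM φ s (mulL hM φ t b) := by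
  simp [mulL]

theorem mulR_add (s t : Multiset X) (b : M) :
    mulR hM φ (s + t) b = mulR hM φ s (mulR hM φ t b) := by
  simp [mulR]

theorem mul_mulL (t : Multiset X) (a b : M) : a * mulL hM φ t b = mulL hM φ t (a * b) := by
  induction t using Multiset.induction with
  | empty => rfl
  | cons z t ih => rw [mulL_cons, mulL_cons, hM.left_comm, ih]

theorem mulR_mul (t : Multiset X) (a b : M) : mulR hM φ t b * a = mulR hM φ t (b * a) := by
  induction t using Multiset.induction with
  | empty => rfl
  | cons z t ih => rw [mulR_cons, mulR_cons, hM.right_comm, ih]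

theorem exists_mulL (t : Multiset X) (c d : M) : ∃ a b, mulL hM φ t (c * d) = a * b := by
  induction t using Multiset.induction with
  | empty => exact ⟨c, d, rfl⟩
  | cons z t ih => exact ⟨_, _, mulL_cons hM φ z t _⟩

theorem exists_mulR (t : Multiset X) (c d : M) : ∃ a b, mulR hM φ t (c * d) = a * b := by
  induction t using Multiset.induction with
  | empty => exact ⟨c, d, rfl⟩
  | cons z t ih => exact ⟨_, _, mulR_cons hM φ z t _⟩

theorem mul_mulR (t : Multiset X) (a c d : M) :
    a * mulR hM φ t (c * d) = mulR hM φ t (a * (c * d)) := by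
  induction t using Multiset.induction with
  | empty => rfl
  | cons z t ih =>
    obtain ⟨e, f, h⟩ := exists_mulR hM φ t c d
    rw [mulR_cons, mulR_cons, ← ih, h, mid_assoc hM]

theorem mulL_mul (t : Multiset X) (a c d : M) :
    mulL hM φ t (c * d) * a = mulL hM φ t (c * d * a) := by
  induction t using Multiset.induction with
  | empty => rfl
  | cons z t ih =>
    obtain ⟨e, f, h⟩ := exists_mulL hM φ t c d
    rw [mulL_cons, mulL_cons, ← ih, h, mid_assoc hM]

theorem mulR_mulL (s t : Multiset X) (c d : M) :
    mulR hM φ s (mulL hM φ t (c * d)) = mulL hM φ t (mulR hM φ s (c * d)) := by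
  induction t using Multiset.induction with
  | empty => rfl
  | cons z t ih =>
    obtain ⟨e, f, h⟩ := exists_mulL hM φ t c d
    rw [mulL_cons, mulL_cons, ← ih, h, mul_mulR]

theorem bracket_congr {z z' y y' : X} {t t' s s' : Multiset X} (h : z ::ₘ t = z' ::ₘ t')
    (h' : y ::ₘ s = y' ::ₘ s') :
    mulL hM φ t (mulR hM φ s (φ z * φ y)) = mulL hM φ t' (mulR hM φ s' (φ z' * φ y')) := by
  have h1 : mulL hM φ t (mulR hM φ s (φ z * φ y)) = mulL hM φ t' (mulR hM φ s (φ z' * φ y)) := by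
    rcases Multiset.cons_eq_cons.1 h with ⟨rfl, rfl⟩ | ⟨-, r, rfl, rfl⟩
    · rfl
    · rw [mulL_cons, mulL_cons, mul_mulL, mul_mulL, mul_mulR, mul_mulR, hM.left_comm]
  have h2 : mulR hM φ s (φ z' * φ y) = mulR hM φ s' (φ z' * φ y') := by
    rcases Multiset.cons_eq_cons.1 h' with ⟨rfl, rfl⟩ | ⟨-, r, rfl, rfl⟩
    · rfl
    · rw [mulR_cons, mulR_cons, mulR_mul, mulR_mul, hM.right_comm]
  rw [h1, h2]

theorem exists_eq_cons {u : Multiset X} (hu : u ≠ 0) : ∃ z t, u = z ::ₘ t := by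
  obtain ⟨z, hz⟩ := Multiset.exists_mem_of_ne_zero hu
  exact ⟨z, Multiset.exists_cons_of_mem hz⟩

/-- The value of a normal form in a bicommutative magma. -/
def eval : NF X → M
  | letter x => φ x
  | pair _ _ hu hv =>
      mulL hM φ (exists_eq_cons hu).choose_spec.choose
        (mulR hM φ (exists_eq_cons hv).choose_spec.choose
          (φ (exists_eq_cons hu).choose * φ (exists_eq_cons hv).choose))

theorem eval_pair {u v : Multiset X} (hu : u ≠ 0) (hv : v ≠ 0) {z y : X} {t s : Multiset X}
    (h : u = z ::ₘ t) (h' : v = y ::ₘ s) :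
    eval hM φ (pair u v hu hv) = mulL hM φ t (mulR hM φ s (φ z * φ y)) :=
  bracket_congr hM φ ((exists_eq_cons hu).choose_spec.choose_spec.symm.trans h)
    ((exists_eq_cons hv).choose_spec.choose_spec.symm.trans h')

theorem eval_mul (μ ν : NF X) : eval hM φ (μ * ν) = eval hM φ μ * eval hM φ ν := by
  cases μ with
  | letter z =>
    cases ν with
    | letter y =>
      exact eval_pair hM φ _ _ (z := z) (y := y) (t := 0) (s := 0) rfl rfl
    | pair u v hu hv =>
      obtain ⟨a, t, rfl⟩ := exists_eq_cons hu
      obtain ⟨b, s, rfl⟩ := exists_eq_cons hv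
      rw [letter_mul_pair, eval_pair hM φ _ _ (Multiset.cons_swap z a t) rfl,
        eval_pair hM φ _ _ rfl rfl, mulL_cons]
      rfl
  | pair u v hu hv =>
    obtain ⟨a, t, rfl⟩ := exists_eq_cons hu
    obtain ⟨b, s, rfl⟩ := exists_eq_cons hv
    cases ν with
    | letter z =>
      obtain ⟨e, f, h⟩ := exists_mulR hM φ s (φ a) (φ b)
      rw [pair_mul_letter, eval_pair hM φ _ _ rfl (Multiset.cons_swap z b s),
        eval_pair hM φ _ _ rfl rfl, mulR_cons, h, ← mulL_mul]
      rfl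
    | pair u' v' hu' hv' =>
      obtain ⟨a', t', rfl⟩ := exists_eq_cons hu'
      obtain ⟨b', s', rfl⟩ := exists_eq_cons hv'
      have e1 : a ::ₘ t + a' ::ₘ t' = a ::ₘ (t' + a' ::ₘ t) := by
        simp only [← Multiset.singleton_add]; ac_rfl
      have e2 : b ::ₘ s + b' ::ₘ s' = b ::ₘ (s' + b' ::ₘ s) := by
        simp only [← Multiset.singleton_add]; ac_rfl
      rw [pair_mul_pair, eval_pair hM φ _ _ e1 e2, eval_pair hM φ _ _ rfl rfl,
        eval_pair hM φ _ _ rfl rfl, mul_mulL, mul_mulR, hM.left_comm _ (φ a') (φ b'),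
        mulL_add, mulR_add]
      obtain ⟨e, f, h⟩ := exists_mulR hM φ s (φ a) (φ b)
      rw [h, mulL_mul, ← h, ← mulR_cons, ← mulL_cons]
      obtain ⟨e', f', h'⟩ := exists_mulR hM φ (b' ::ₘ s) (φ a) (φ b)
      rw [h', mulR_mulL]

/-- Two multiplicative maps on the normal forms that agree on the letters are equal. -/
theorem hom_ext {F G : NF X →ₙ* M} (h : ∀ x, F (letter x) = G (letter x)) : F = G := by
  have key : ∀ (z y : X) (t s : Multiset X),
      F (pair (z ::ₘ t) (y ::ₘ s) Multiset.cons_ne_zero Multiset.cons_ne_zero) =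
        G (pair (z ::ₘ t) (y ::ₘ s) Multiset.cons_ne_zero Multiset.cons_ne_zero) := by
    intro z y t s
    induction t using Multiset.induction generalizing z with
    | empty =>
      induction s using Multiset.induction generalizing y with
      | empty =>
        change F (letter z * letter y) = G (letter z * letter y)
        rw [map_mul, map_mul, h, h]
      | cons w s ih =>
        have e := pair_mul_letter y (z ::ₘ 0) (w ::ₘ s) Multiset.cons_ne_zero Multiset.cons_ne_zero
        rw [← e, map_mul, map_mul, ih, h]
    | cons w t ih =>
      have e := letter_mul_pair z (w ::ₘ t) (y ::ₘ s) Multiset.cons_ne_zero Multiset.cons_ne_zero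
      rw [← e, map_mul, map_mul, ih, h]
  ext μ
  cases μ with
  | letter x => exact h x
  | pair u v hu hv =>
    obtain ⟨a, t, rfl⟩ := exists_eq_cons hu
    obtain ⟨b, s, rfl⟩ := exists_eq_cons hv
    exact key a b t s

end lift

end NF

/-! ### The free bicommutative algebra -/

/-- The free bicommutative algebra `BC(X)` over `k`: the vector space with basis `NF(X)`, whose
product is the bilinear extension of the multiplication table of the normal forms. It is
bicommutative (`BC.isBicommutative`) and it has the universal property of the free bicommutative
algebra on `X` (`BC.existsUnique_lift`). -/
abbrev BC (k X : Type*) [Field k] : Type _ := MonoidAlgebra k (NF X)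

namespace BC

variable {k X : Type*} [Field k]

/-- The generator of `BC(X)` given by a letter. -/
def of (k : Type*) {X : Type*} [Field k] (x : X) : BC k X := MonoidAlgebra.single (NF.letter x) 1

theorem isBicommutative (k X : Type*) [Field k] : IsBicommutative (BC k X) where
  left_comm a b c := by
    induction a using MonoidAlgebra.induction_linear with
    | zero => simp
    | add f g hf hg => simp only [add_mul, mul_add, hf, hg]
    | single μ p =>
    induction b using MonoidAlgebra.induction_linear with
    | zero => simp
    | add f g hf hg => simp only [add_mul, mul_add, hf, hg]
    | single ν q =>
    induction c using MonoidAlgebra.induction_linear with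
    | zero => simp
    | add f g hf hg => simp only [mul_add, hf, hg]
    | single ρ r =>
      simp only [MonoidAlgebra.single_mul_single, NF.isBicommutative.left_comm μ ν ρ,
        mul_left_comm p q r]
  right_comm a b c := by
    induction a using MonoidAlgebra.induction_linear with
    | zero => simp
    | add f g hf hg => simp only [add_mul, hf, hg]
    | single μ p =>
    induction b using MonoidAlgebra.induction_linear with
    | zero => simp
    | add f g hf hg => simp only [add_mul, mul_add, hf, hg]
    | single ν q =>
    induction c using MonoidAlgebra.induction_linear with
    | zero => simp
    | add f g hf hg => simp only [add_mul, mul_add, hf, hg]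
    | single ρ r =>
      simp only [MonoidAlgebra.single_mul_single, NF.isBicommutative.right_comm μ ν ρ,
        mul_right_comm p q r]

/-- Universal property: every map from `X` to a bicommutative algebra extends uniquely to an
algebra homomorphism on `BC(X)`. -/
theorem existsUnique_lift {A : Type*} [NonUnitalNonAssocRing A] [Module k A] [IsScalarTower k A A]
    [SMulCommClass k A A] (hA : IsBicommutative A) (φ : X → A) :
    ∃! F : BC k X →ₙₐ[k] A, ∀ x, F (of k x) = φ x := by
  refine ⟨MonoidAlgebra.liftMagma k ⟨NF.eval hA φ, NF.eval_mul hA φ⟩, fun x => ?_, ?_⟩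
  · simp [of, MonoidAlgebra.liftMagma, NF.eval]
  · intro G hG
    rw [← Equiv.symm_apply_eq]
    refine NF.hom_ext fun x => ?_
    exact hG x

/-- In `BC(X)` the basis element `[z t; y s]` is the bracketed product
`z₁ (⋯ (z_p ((⋯ ((z y) y₁) ⋯) y_q)) ⋯)`, where `t = z₁ ⋯ z_p` and `s = y₁ ⋯ y_q`. -/
theorem single_pair (z y : X) (t s : Multiset X) :
    (MonoidAlgebra.single (NF.pair (z ::ₘ t) (y ::ₘ s) Multiset.cons_ne_zero
        Multiset.cons_ne_zero) 1 : BC k X) =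
      NF.mulL (isBicommutative k X) (of k) t
        (NF.mulR (isBicommutative k X) (of k) s (of k z * of k y)) := by
  rw [← NF.eval_pair (isBicommutative k X) (of k) Multiset.cons_ne_zero Multiset.cons_ne_zero
    rfl rfl]
  have e : MonoidAlgebra.ofMagma k (NF X) =
      (⟨NF.eval (isBicommutative k X) (of k), NF.eval_mul (isBicommutative k X) (of k)⟩ :
        NF X →ₙ* BC k X) := NF.hom_ext fun x => rfl
  exact DFunLike.congr_fun e _

end BC

/-! ### Ideals and quotient algebras -/

/-- A (two-sided) ideal of a not necessarily associative algebra: a linear subspace that absorbs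
multiplication from both sides. -/
structure AlgIdeal (k A : Type*) [Field k] [NonUnitalNonAssocRing A] [Module k A] extends
    Submodule k A where
  mul_mem_left : ∀ a b : A, b ∈ carrier → a * b ∈ carrier
  mul_mem_right : ∀ a b : A, a ∈ carrier → a * b ∈ carrier

namespace AlgIdeal

variable {k A : Type*} [Field k] [NonUnitalNonAssocRing A] [Module k A]

/-- The ideal `Id(S)` generated by a set `S`: the intersection of all ideals that contain `S`. -/
def span (k : Type*) {A : Type*} [Field k] [NonUnitalNonAssocRing A] [Module k A] (S : Set A) :
    AlgIdeal k A where
  toSubmodule := sInf {p | ∃ I : AlgIdeal k A, I.toSubmodule = p ∧ S ⊆ (I.toSubmodule : Set A)}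
  mul_mem_left a b hb := by
    rw [AddSubsemigroup.mem_carrier, AddSubmonoid.mem_toSubsemigroup,
      Submodule.mem_toAddSubmonoid, Submodule.mem_sInf] at hb ⊢
    rintro _ ⟨I, rfl, hI⟩
    exact I.mul_mem_left a b (hb _ ⟨I, rfl, hI⟩)
  mul_mem_right a b ha := by
    rw [AddSubsemigroup.mem_carrier, AddSubmonoid.mem_toSubsemigroup,
      Submodule.mem_toAddSubmonoid, Submodule.mem_sInf] at ha ⊢
    rintro _ ⟨I, rfl, hI⟩
    exact I.mul_mem_right a b (ha _ ⟨I, rfl, hI⟩)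

/-- The quotient of an algebra by an ideal. -/
def Quotient (I : AlgIdeal k A) : Type _ := A ⧸ I.toSubmodule

variable (I : AlgIdeal k A)

instance : AddCommGroup I.Quotient := inferInstanceAs (AddCommGroup (A ⧸ I.toSubmodule))

instance : Module k I.Quotient := inferInstanceAs (Module k (A ⧸ I.toSubmodule))

/-- The quotient map. -/
def proj : A →ₗ[k] I.Quotient := I.toSubmodule.mkQ

theorem proj_surjective : Function.Surjective I.proj := I.toSubmodule.mkQ_surjective

theorem proj_eq_proj {a b : A} : I.proj a = I.proj b ↔ a - b ∈ I.toSubmodule :=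
  Submodule.Quotient.eq I.toSubmodule

instance : Mul I.Quotient where
  mul := Quotient.map₂ (· * ·) (by
    intro a a' ha b b' hb
    have ha' : a - a' ∈ I.toSubmodule := (Submodule.quotientRel_def _).1 ha
    have hb' : b - b' ∈ I.toSubmodule := (Submodule.quotientRel_def _).1 hb
    refine (Submodule.quotientRel_def _).2 ?_
    have e : a * b - a' * b' = (a - a') * b + a' * (b - b') := by
      rw [sub_mul, mul_sub]; abel
    rw [e]
    exact add_mem (I.mul_mem_right _ _ ha') (I.mul_mem_left _ _ hb'))

theorem proj_mul (a b : A) : I.proj (a * b) = I.proj a * I.proj b := rfl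

instance : NonUnitalNonAssocRing I.Quotient where
  left_distrib a b c := by
    obtain ⟨a, rfl⟩ := I.proj_surjective a
    obtain ⟨b, rfl⟩ := I.proj_surjective b
    obtain ⟨c, rfl⟩ := I.proj_surjective c
    simp only [← map_add, ← proj_mul, mul_add]
  right_distrib a b c := by
    obtain ⟨a, rfl⟩ := I.proj_surjective a
    obtain ⟨b, rfl⟩ := I.proj_surjective b
    obtain ⟨c, rfl⟩ := I.proj_surjective c
    simp only [← map_add, ← proj_mul, add_mul]
  zero_mul a := by
    obtain ⟨a, rfl⟩ := I.proj_surjective a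
    rw [← map_zero I.proj, ← proj_mul, zero_mul]
  mul_zero a := by
    obtain ⟨a, rfl⟩ := I.proj_surjective a
    rw [← map_zero I.proj, ← proj_mul, mul_zero]

instance [IsScalarTower k A A] : IsScalarTower k I.Quotient I.Quotient where
  smul_assoc c a b := by
    obtain ⟨a, rfl⟩ := I.proj_surjective a
    obtain ⟨b, rfl⟩ := I.proj_surjective b
    simp only [smul_eq_mul, ← map_smul, ← proj_mul, smul_mul_assoc]

instance [SMulCommClass k A A] : SMulCommClass k I.Quotient I.Quotient where
  smul_comm c a b := by
    obtain ⟨a, rfl⟩ := I.proj_surjective a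
    obtain ⟨b, rfl⟩ := I.proj_surjective b
    simp only [smul_eq_mul, ← map_smul, ← proj_mul, mul_smul_comm]

end AlgIdeal

/-- The bicommutative algebra `BC(X | S) = BC(X) / Id(S)`. -/
abbrev BCQuot {k X : Type*} [Field k] (S : Set (BC k X)) : Type _ := (AlgIdeal.span k S).Quotient

/-! ### Gröbner–Shirshov bases -/

section GSB

variable {k X : Type*} [Field k] [LinearOrder (NF X)]

/-- The given linear order on `NF(X)` is a monomial order: it is a well order, and it is
compatible with multiplication from both sides (a product of normal forms is a normal form). -/
structure IsMonomialOrder (X : Type*) [LinearOrder (NF X)] : Prop where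
  wf : WellFoundedLT (NF X)
  mul_lt_mul_right : ∀ μ ν ρ : NF X, μ < ν → μ * ρ < ν * ρ
  mul_lt_mul_left : ∀ μ ν ρ : NF X, μ < ν → ρ * μ < ρ * ν

/-- The leading monomial of an element of `BC(X)`; it is `⊥` exactly for the zero element. -/
def leadMon (f : BC k X) : WithBot (NF X) := f.coeff.support.max

/-- An element of `BC(X)` is monic if it is nonzero and its leading coefficient is `1`. -/
def IsMonic (f : BC k X) : Prop := ∃ μ : NF X, leadMon f = (μ : WithBot (NF X)) ∧ f.coeff μ = 1

/-- The left-normed product `(⋯((f y₁) y₂)⋯) y_q` with letters `y₁, …, y_q`. -/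
def lNormed (f : BC k X) (ys : List X) : BC k X := ys.foldl (fun g y => g * BC.of k y) f

/-- The right-normed product `z₁ (z₂ (⋯ (z_p f)⋯))` with letters `z₁, …, z_p`. -/
def rNormed (zs : List X) (f : BC k X) : BC k X := zs.foldr (fun z g => BC.of k z * g) f

/-- Normal `S`-polynomials: every `s ∈ S`; and, if the leading monomial of `s ∈ S` has length at
least `2`, all `z₁ (⋯ (z_p ((⋯ (s y₁) ⋯) y_q)) ⋯)` with letters `z_i`, `y_j` and `p, q ≥ 0`. -/
inductive IsNormalPoly (S : Set (BC k X)) : BC k X → Prop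
  | base (s : BC k X) (hs : s ∈ S) : IsNormalPoly S s
  | extend (s : BC k X) (hs : s ∈ S) (μ : NF X) (hμ : leadMon s = (μ : WithBot (NF X)))
      (hl : 2 ≤ μ.length) (zs ys : List X) : IsNormalPoly S (rNormed zs (lNormed s ys))

/-- `S` is a Gröbner–Shirshov basis for `BC(X | S)`: it is a monic set, and the leading monomial of
every nonzero element of `Id(S)` is the leading monomial of a normal `S`-polynomial. -/
structure IsGSBasis (S : Set (BC k X)) : Prop where
  monic : ∀ s ∈ S, IsMonic s
  lead : ∀ f ∈ (AlgIdeal.span k S).toSubmodule, f ≠ 0 →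
    ∃ h : BC k X, IsNormalPoly S h ∧ leadMon f = leadMon h

end GSB

/-! ### Gelfand–Kirillov dimension -/

section GKDim

variable {k A : Type*} [Field k] [NonUnitalNonAssocRing A] [Module k A]

/-- The subspace `(V W)` spanned by all products `x y` with `x ∈ V`, `y ∈ W`. -/
def prodSpan (V W : Submodule k A) : Submodule k A :=
  Submodule.span k {a | ∃ x ∈ V, ∃ y ∈ W, a = x * y}

/-- `V¹ = V` and `Vⁿ = ∑_{1 ≤ i ≤ n - 1} (Vⁱ Vⁿ⁻ⁱ)` for `n ≥ 2` (the value at `0` is not used). -/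
def subPow (V : Submodule k A) : ℕ → Submodule k A
  | 0 => ⊥
  | 1 => V
  | n + 2 => ⨆ i : Fin (n + 1), prodSpan (subPow V (i + 1)) (subPow V (n + 1 - i))

/-- `V^{≤ n} = V¹ + V² + ⋯ + Vⁿ`. -/
def subPowLE (V : Submodule k A) (n : ℕ) : Submodule k A := ⨆ i ∈ Finset.Icc 1 n, subPow V i

/-- The Gelfand–Kirillov dimension `sup_V limsup_{n → ∞} log_n dim V^{≤ n}`, where `V` runs through
all finite dimensional subspaces. The convention `log_n 0 = 0` only matters for the zero algebra,
whose dimension is thereby `0`. -/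
def gkDim (k A : Type*) [Field k] [NonUnitalNonAssocRing A] [Module k A] : EReal :=
  ⨆ V : {V : Submodule k A // FiniteDimensional k V},
    Filter.limsup
      (fun n : ℕ => ((Real.logb n (Module.finrank k (subPowLE V.1 n)) : ℝ) : EReal)) Filter.atTop

end GKDim

end Bicomm

end

/-!
The normal forms `[u; v]` multiply like monomials in two sets of variables, so they are encoded by
exponent vectors in `ℕ^(X ⊕ X)`, and passing to normal `S`-polynomials amounts to divisibility.
For a Gröbner–Shirshov basis the standard pairs, which are the `[u; v]` not divisible by any
leading monomial `[u'; v']` of `S`, are linearly independent modulo `Id(S)`, and together with the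
letters they span. Reduction may increase lengths, because a monomial order need not refine the
length. However, the finitely many comparisons between monomials of elements of `S` are also
realised by a positive integral weight, which reduction does not increase and which is comparable
with the length up to a constant factor. Hence `BC(X | S)` grows like the number of standard pairs.

Their exponents form a finite union of coordinate cones `c + ℕ^T`, so the Gelfand–Kirillov
dimension is the largest `|T|` that occurs. A cone in all `2r` directions would contain multiples
of a leading monomial, so the dimension is less than `2r`. If `t ≤ r`, all leading monomials
disappear when one right-hand letter of the first of them and one left-hand letter of each of the
others are set to zero; at least one letter survives on each side, and the remaining directions,
at least `2r - t` of them, span a cone of standard pairs.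
-/

noncomputable section

namespace Bicomm

/-! ### Growth of unions of coordinate cones -/

section CoordinateCones

open Finset Filter Asymptotics

variable {σ : Type*}

/-- The coordinate cone `c + ℕ^T` with vertex `c` and directions `T`. -/
def coordCone (T : Finset σ) (c : σ → ℕ) : Set (σ → ℕ) := {d | c ≤ d ∧ ∀ i ∉ T, d i = c i}

/-- Membership in `P` depends only on the vector truncated at height `K`. -/
def IsTruncationInvariant (P : Set (σ → ℕ)) (K : ℕ) : Prop :=
  ∀ ⦃d d' : σ → ℕ⦄, (∀ i, min (d i) K = min (d' i) K) → d ∈ P → d' ∈ P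

/-- The largest number of directions of a coordinate cone contained in `P`. It is the degree of
growth of `P` when `P` is a finite union of coordinate cones, and `0` when `P` is empty. -/
def coneDim (P : Set (σ → ℕ)) : ℕ := sSup {m | ∃ T c, coordCone T c ⊆ P ∧ #T = m}

theorem coneDim_empty : coneDim (∅ : Set (σ → ℕ)) = 0 := by
  have no_cone : {m | ∃ T c, coordCone T c ⊆ (∅ : Set (σ → ℕ)) ∧ #T = m} = ∅ :=
    Set.eq_empty_of_forall_notMem fun _ ⟨_, _, h, _⟩ => h ⟨le_rfl, fun _ _ => rfl⟩
  rw [coneDim, no_cone, csSup_empty, bot_eq_zero]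

section Finite

variable [Finite σ]

theorem bddAbove_card_coordCone_subset (P : Set (σ → ℕ)) :
    BddAbove {m | ∃ T c, coordCone T c ⊆ P ∧ #T = m} := by
  have := Fintype.ofFinite σ
  exact ⟨Fintype.card σ, fun _ ⟨T, _, _, hm⟩ => hm ▸ card_le_univ T⟩

theorem card_le_coneDim {P : Set (σ → ℕ)} {T : Finset σ} {c : σ → ℕ} (h : coordCone T c ⊆ P) :
    #T ≤ coneDim P :=
  le_csSup (bddAbove_card_coordCone_subset P) ⟨T, c, h, rfl⟩

theorem exists_coordCone_subset_card_eq_coneDim {P : Set (σ → ℕ)} (hP : P.Nonempty) :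
    ∃ T c, coordCone T c ⊆ P ∧ #T = coneDim P := by
  obtain ⟨c, hc⟩ := hP
  have hcone : coordCone ∅ c ⊆ P := fun d hd => by
    rwa [funext fun i => hd.2 i (notMem_empty i)]
  exact Nat.sSup_mem (s := {m | ∃ T c, coordCone T c ⊆ P ∧ #T = m})
    ⟨0, ∅, c, hcone, card_empty⟩ (bddAbove_card_coordCone_subset P)

end Finite

variable [Fintype σ]

/-- The number of vectors in `P` with coordinate sum at most `n`. -/
def growth (P : Set (σ → ℕ)) (n : ℕ) : ℕ := {d ∈ P | ∑ i, d i ≤ n}.ncard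

theorem finite_setOf_mem_and_sum_le (P : Set (σ → ℕ)) (n : ℕ) : {d ∈ P | ∑ i, d i ≤ n}.Finite := by
  classical
  exact (Set.finite_Icc 0 fun _ => n).subset fun d hd => ⟨fun _ => Nat.zero_le _, fun i =>
    (single_le_sum (f := d) (fun _ _ => Nat.zero_le _) (mem_univ i)).trans hd.2⟩

theorem growth_mono {P Q : Set (σ → ℕ)} (h : P ⊆ Q) (n : ℕ) : growth P n ≤ growth Q n :=
  Set.ncard_le_ncard (fun _ hd => ⟨h hd.1, hd.2⟩) (finite_setOf_mem_and_sum_le Q n)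

theorem growth_coordCone_le (T : Finset σ) (c : σ → ℕ) (n : ℕ) :
    growth (coordCone T c) n ≤ (n + 1) ^ #T := by
  classical
  have hsub : {d ∈ coordCone T c | ∑ i, d i ≤ n} ⊆
      Fintype.piFinset fun i => if i ∈ T then range (n + 1) else {c i} := by
    rintro d ⟨hd, hn⟩
    refine mem_coe.2 (Fintype.mem_piFinset.2 fun i => ?_)
    split_ifs with hi
    · exact mem_range_succ_iff.2 <|
        (single_le_sum (f := d) (fun _ _ => Nat.zero_le _) (mem_univ i)).trans hn
    · exact mem_singleton.2 (hd.2 i hi)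
  calc growth (coordCone T c) n
      ≤ #(Fintype.piFinset fun i => if i ∈ T then range (n + 1) else {c i}) :=
        (Set.ncard_le_ncard hsub (finite_toSet _)).trans_eq (Set.ncard_coe_finset _)
    _ = ∏ i, if i ∈ T then n + 1 else 1 := by
        simp only [Fintype.card_piFinset, apply_ite card, card_range, card_singleton]
    _ = (n + 1) ^ #T := by simp only [prod_ite_mem, univ_inter, prod_const]

theorem le_growth_coordCone (T : Finset σ) (c : σ → ℕ) {k n : ℕ}
    (h : Fintype.card σ * k + ∑ i, c i ≤ n) : (k + 1) ^ #T ≤ growth (coordCone T c) n := by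
  classical
  have hsub : ((Fintype.piFinset fun i => if i ∈ T then Icc (c i) (c i + k) else {c i} :
      Finset (σ → ℕ)) : Set (σ → ℕ)) ⊆ {d ∈ coordCone T c | ∑ i, d i ≤ n} := by
    intro d hd
    replace hd : ∀ i, c i ≤ d i ∧ d i ≤ c i + k ∧ (i ∉ T → d i = c i) := fun i => by
      have := Fintype.mem_piFinset.1 (mem_coe.1 hd) i
      split_ifs at this with hi
      · exact ⟨(mem_Icc.1 this).1, (mem_Icc.1 this).2, fun h => (h hi).elim⟩
      · rw [mem_singleton.1 this]
        exact ⟨le_rfl, Nat.le_add_right _ _, fun _ => rfl⟩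
    refine ⟨⟨fun i => (hd i).1, fun i => (hd i).2.2⟩, ?_⟩
    calc ∑ i, d i ≤ ∑ i, (c i + k) := sum_le_sum fun i _ => (hd i).2.1
      _ = Fintype.card σ * k + ∑ i, c i := by
        rw [sum_add_distrib, sum_const, smul_eq_mul, card_univ, add_comm]
      _ ≤ n := h
  calc (k + 1) ^ #T = ∏ i, if i ∈ T then k + 1 else 1 := by
        simp only [prod_ite_mem, univ_inter, prod_const]
    _ = #(Fintype.piFinset fun i => if i ∈ T then Icc (c i) (c i + k) else {c i}) := by
        simp only [Fintype.card_piFinset, apply_ite card, Nat.card_Icc, card_singleton, add_assoc,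
          Nat.add_sub_cancel_left]
    _ ≤ growth (coordCone T c) n :=
        (Set.ncard_coe_finset _).symm.trans_le
          (Set.ncard_le_ncard hsub (finite_setOf_mem_and_sum_le _ n))

theorem IsTruncationInvariant.coordCone_subset {P : Set (σ → ℕ)} {K : ℕ}
    (hP : IsTruncationInvariant P K) {c : σ → ℕ} (hc : c ∈ P) :
    coordCone {i | K ≤ c i} c ⊆ P := by
  refine fun d hd => hP (fun i => ?_) hc
  by_cases hi : K ≤ c i
  · rw [min_eq_right hi, min_eq_right (hi.trans (hd.1 i))]
  · rw [hd.2 i (by simpa using hi)]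

theorem IsTruncationInvariant.subset_iUnion_coordCone {P : Set (σ → ℕ)} {K : ℕ}
    (hP : IsTruncationInvariant P K) :
    P ⊆ ⋃ c ∈ {c ∈ P | c ≤ fun _ => K}, coordCone {i | K ≤ c i} c := by
  refine fun d hd => Set.mem_biUnion (x := fun i => min (d i) K) ?_ ?_
  · exact ⟨hP (fun i => by rw [min_assoc, min_self]) hd, fun i => min_le_right _ _⟩
  · refine ⟨fun i => min_le_left _ _, fun i hi => (min_eq_left ?_).symm⟩
    simp only [le_min_iff, le_refl, and_true, mem_filter_univ, not_le] at hi
    exact hi.le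

theorem IsTruncationInvariant.growth_le {P : Set (σ → ℕ)} {K : ℕ}
    (hP : IsTruncationInvariant P K) (n : ℕ) :
    growth P n ≤ (Set.Icc 0 fun _ : σ => K).ncard * (n + 1) ^ coneDim P := by
  classical
  have hfin : {c ∈ P | c ≤ fun _ => K}.Finite :=
    (Set.finite_Icc 0 fun _ => K).subset fun _ h => ⟨fun _ => Nat.zero_le _, h.2⟩
  have hsub : {d ∈ P | ∑ i, d i ≤ n} ⊆
      ⋃ c ∈ hfin.toFinset, {d ∈ coordCone {i | K ≤ c i} c | ∑ i, d i ≤ n} := by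
    rintro d ⟨hd, hn⟩
    obtain ⟨c, hc, hdc⟩ := Set.mem_iUnion₂.1 (hP.subset_iUnion_coordCone hd)
    exact Set.mem_biUnion (hfin.mem_toFinset.2 hc) ⟨hdc, hn⟩
  calc growth P n
      ≤ (⋃ c ∈ hfin.toFinset, {d ∈ coordCone {i | K ≤ c i} c | ∑ i, d i ≤ n}).ncard :=
        Set.ncard_le_ncard hsub
          (hfin.toFinset.finite_toSet.biUnion fun _ _ => finite_setOf_mem_and_sum_le _ n)
    _ ≤ ∑ c ∈ hfin.toFinset, growth (coordCone {i | K ≤ c i} c) n := set_ncard_biUnion_le _ _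
    _ ≤ ∑ _c ∈ hfin.toFinset, (n + 1) ^ coneDim P := by
        refine sum_le_sum fun c hc => (growth_coordCone_le _ c n).trans ?_
        exact Nat.pow_le_pow_right n.succ_pos
          (card_le_coneDim (hP.coordCone_subset (hfin.mem_toFinset.1 hc).1))
    _ ≤ (Set.Icc 0 fun _ : σ => K).ncard * (n + 1) ^ coneDim P := by
        rw [sum_const, smul_eq_mul, ← Set.ncard_eq_toFinset_card _ hfin]
        gcongr
        · exact Set.finite_Icc _ _
        · exact fun _ h => ⟨fun _ => Nat.zero_le _, h.2⟩

theorem IsTruncationInvariant.growth_isBigO {P : Set (σ → ℕ)} {K : ℕ}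
    (hP : IsTruncationInvariant P K) :
    (fun n => (growth P n : ℝ)) =O[atTop] fun n : ℕ => (n : ℝ) ^ coneDim P := by
  have hsucc : (fun n : ℕ => ((n + 1 : ℕ) : ℝ)) =O[atTop] fun n : ℕ => (n : ℝ) :=
    .of_bound 2 <| (eventually_ge_atTop 1).mono fun n hn => by
      rw [Real.norm_natCast, Real.norm_natCast]
      norm_cast
      lia
  refine IsBigO.trans (.of_bound (Set.Icc 0 fun _ : σ => K).ncard (.of_forall fun n => ?_))
    (hsucc.pow (coneDim P))
  rw [norm_pow, Real.norm_natCast, Real.norm_natCast]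
  exact_mod_cast hP.growth_le n

theorem pow_coneDim_isBigO_growth {P : Set (σ → ℕ)} (hP : P.Nonempty) :
    (fun n : ℕ => (n : ℝ) ^ coneDim P) =O[atTop] fun n => (growth P n : ℝ) := by
  obtain ⟨T, c, hTc, hT⟩ := exists_coordCone_subset_card_eq_coneDim hP
  set a := Fintype.card σ
  set s := ∑ i, c i
  refine .of_bound ((a + 1 + s : ℕ) ^ coneDim P : ℕ) <| (eventually_ge_atTop s).mono fun n hn => ?_
  obtain ⟨e, rfl⟩ := Nat.exists_eq_add_of_le hn
  set k := e / (a + 1)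
  have hk : (a + 1) * k ≤ e := Nat.mul_div_le _ _
  have hk' : e < (a + 1) * (k + 1) := Nat.lt_mul_div_succ _ a.succ_pos
  have hcone : (k + 1) ^ #T ≤ growth P (s + e) :=
    (le_growth_coordCone T c (by change a * k + s ≤ s + e; linarith)).trans (growth_mono hTc _)
  rw [norm_pow, Real.norm_natCast, Real.norm_natCast]
  norm_cast
  calc (s + e) ^ coneDim P ≤ ((a + 1 + s) * (k + 1)) ^ coneDim P := by gcongr; nlinarith
    _ = (a + 1 + s) ^ coneDim P * (k + 1) ^ #T := by rw [mul_pow, hT]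
    _ ≤ (a + 1 + s) ^ coneDim P * growth P (s + e) := by gcongr

end CoordinateCones

/-! ### Integral weights for strict comparisons -/

section PositiveFunctional

open Finset Matrix

variable {ι σ : Type*}

theorem exists_forall_pos_mul_add_mul (s : Finset ι) (a b : ι → ℤ)
    (hzero : ∀ i ∈ s, a i = 0 → 0 < b i)
    (hcross : ∀ i ∈ s, ∀ j ∈ s, 0 < a i → a j < 0 → 0 < a i * b j - a j * b i) :
    ∃ p q : ℤ, ∀ i ∈ s, 0 < a i * p + b i * q := by
  classical
  obtain ⟨t, hlow, hupp⟩ := Order.exists_between_finsets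
    ({i ∈ s | 0 < a i}.image fun i => (-b i / a i : ℚ))
    ({i ∈ s | a i < 0}.image fun i => (-b i / a i : ℚ)) (by
      simp only [forall_mem_image, mem_filter]
      rintro i ⟨hi, hai⟩ j ⟨hj, haj⟩
      have hc := hcross i hi j hj hai haj
      qify at hai haj hc
      rw [div_lt_iff₀ hai, div_mul_eq_mul_div, lt_div_iff_of_neg haj]
      linarith)
  refine ⟨t.num, t.den, fun i hi => ?_⟩
  have hden : (0 : ℚ) < t.den := by exact_mod_cast t.den_pos
  suffices h : (0 : ℚ) < a i * t + b i by
    have := mul_pos h hden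
    rw [add_mul, mul_assoc, Rat.mul_den_eq_num] at this
    exact_mod_cast this
  rcases lt_trichotomy (a i) 0 with hai | hai | hai
  · have h := hupp _ (mem_image_of_mem _ (mem_filter.2 ⟨hi, hai⟩))
    rw [lt_div_iff_of_neg (by exact_mod_cast hai)] at h
    linarith
  · have h : (0 : ℚ) < b i := by exact_mod_cast hzero i hi hai
    simpa [hai] using h
  · have h := hlow _ (mem_image_of_mem _ (mem_filter.2 ⟨hi, hai⟩))
    rw [div_lt_iff₀ (by exact_mod_cast hai)] at h
    linarith

theorem zsmul_mem_of_pos {M : Type*} [AddCommGroup M] (G : AddSubsemigroup M) {n : ℤ} (hn : 0 < n)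
    {a : M} (ha : a ∈ G) : n • a ∈ G := by
  obtain ⟨n, rfl⟩ := Int.eq_succ_of_zero_lt hn
  clear hn
  rw [← Nat.cast_succ, natCast_zsmul]
  induction n with
  | zero => rwa [one_nsmul]
  | succ n ih => exact succ_nsmul a (n + 1) ▸ add_mem ih ha

variable [Fintype σ]

theorem exists_pos_dotProduct_of_forall_notMem_eq_zero {G : AddSubsemigroup (σ → ℤ)} (h0 : 0 ∉ G)
    (s : Finset σ) : ∀ D : Finset (σ → ℤ), (∀ d ∈ D, d ∈ G) → (∀ d ∈ D, ∀ i ∉ s, d i = 0) →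
      ∃ w : σ → ℤ, ∀ d ∈ D, 0 < w ⬝ᵥ d := by
  classical
  -- Fourier–Motzkin elimination of the coordinate `a`.
  induction s using Finset.induction_on with
  | empty =>
    refine fun D hG hD => ⟨0, fun d hd => (h0 ?_).elim⟩
    have hd0 : d = 0 := funext fun i => hD d hd i (notMem_empty i)
    exact hd0 ▸ hG d hd
  | insert a s ha ih =>
    intro D hG hD
    let D' : Finset (σ → ℤ) := {d ∈ D | d a = 0} ∪
      image₂ (fun p q => p a • q + (-q a) • p) {d ∈ D | 0 < d a} {d ∈ D | d a < 0}
    have hD'G : ∀ d ∈ D', d ∈ G := by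
      simp only [D', mem_union, mem_filter, mem_image₂]
      rintro _ (⟨hd, -⟩ | ⟨p, ⟨hp, hpa⟩, q, ⟨hq, hqa⟩, rfl⟩)
      · exact hG _ hd
      · exact add_mem (zsmul_mem_of_pos G hpa (hG q hq))
          (zsmul_mem_of_pos G (neg_pos.2 hqa) (hG p hp))
    have hD'0 : ∀ d ∈ D', ∀ i ∉ s, d i = 0 := by
      simp only [D', mem_union, mem_filter, mem_image₂]
      rintro _ (⟨hd, hda⟩ | ⟨p, ⟨hp, hpa⟩, q, ⟨hq, hqa⟩, rfl⟩) i hi <;>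
        rcases eq_or_ne i a with rfl | hia
      · exact hda
      · exact hD _ hd i (by simp [hia, hi])
      · simp only [Pi.add_apply, Pi.smul_apply, smul_eq_mul]; ring
      · simp [hD p hp i (by simp [hia, hi]), hD q hq i (by simp [hia, hi])]
    obtain ⟨w, hw⟩ := ih D' hD'G hD'0
    obtain ⟨p, q, hpq⟩ := exists_forall_pos_mul_add_mul D (fun d => d a) (fun d => w ⬝ᵥ d)
      (fun d hd hda => hw d (mem_union_left _ (mem_filter.2 ⟨hd, hda⟩)))
      (fun d hd e he hda hea => by
        have := hw _ (mem_union_right _ (mem_image₂_of_mem (mem_filter.2 ⟨hd, hda⟩)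
          (mem_filter.2 ⟨he, hea⟩)))
        simpa only [dotProduct_add, dotProduct_smul, smul_eq_mul, neg_mul, ← sub_eq_add_neg]
          using this)
    refine ⟨Pi.single a p + q • w, fun d hd => ?_⟩
    rw [add_dotProduct, single_dotProduct, smul_dotProduct, smul_eq_mul]
    linarith [hpq d hd]

theorem exists_pos_dotProduct {G : AddSubsemigroup (σ → ℤ)} (h0 : 0 ∉ G) (D : Finset (σ → ℤ))
    (hD : ∀ d ∈ D, d ∈ G) : ∃ w : σ → ℤ, ∀ d ∈ D, 0 < w ⬝ᵥ d :=
  exists_pos_dotProduct_of_forall_notMem_eq_zero h0 univ D hD fun _ _ i hi =>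
    (hi (mem_univ i)).elim

end PositiveFunctional

/-! ### Exponents and weights of normal forms -/

namespace NF

open Finset

variable {X : Type*}

/-- The normal forms `[u; v]`, as opposed to the letters. -/
def IsPair : NF X → Prop
  | letter _ => False
  | pair _ _ _ _ => True

open scoped Classical in
/-- The exponents of the letters of `u` and of `v` in `[u; v]`. Letters get the dummy value `0`:
they are the only normal forms that do not behave like monomials in two sets of variables. -/
def exponent : NF X → X ⊕ X → ℕ
  | letter _ => 0
  | pair u v _ _ => Sum.elim u.count v.count

/-- The weight of a normal form when each letter has a weight `w (Sum.inl x)` on the left and a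
weight `w (Sum.inr x)` on the right. A single letter gets the larger of its two weights, because
it may end up on either side of a product. -/
def weight (w : X ⊕ X → ℕ) : NF X → ℕ
  | letter x => max (w (.inl x)) (w (.inr x))
  | pair u v _ _ => (u.map (w ∘ .inl)).sum + (v.map (w ∘ .inr)).sum

/-- The normal form `z₁ (⋯ (z_p ((⋯ (μ y₁) ⋯) y_q)) ⋯)`. -/
def shift (zs ys : List X) (μ : NF X) : NF X :=
  zs.foldr (fun z ν => letter z * ν) (ys.foldl (fun ν y => ν * letter y) μ)

theorem isPair_mul (μ ν : NF X) : (μ * ν).IsPair := by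
  cases μ <;> cases ν <;> trivial

theorem two_le_length_iff_isPair {μ : NF X} : 2 ≤ μ.length ↔ μ.IsPair := by
  cases μ with
  | letter x => simp [length, IsPair]
  | pair u v hu hv =>
    have := Multiset.card_pos.2 hu
    have := Multiset.card_pos.2 hv
    simp only [length, IsPair, iff_true]
    lia

theorem exponent_mul {μ ν : NF X} (hμ : μ.IsPair) (hν : ν.IsPair) :
    (μ * ν).exponent = μ.exponent + ν.exponent := by
  cases μ with
  | letter x => exact hμ.elim
  | pair u v hu hv =>
    cases ν with
    | letter x => exact hν.elim
    | pair u' v' hu' hv' =>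
      classical
      ext (x | x)
      · exact Multiset.count_add x u u'
      · exact Multiset.count_add x v v'

open scoped Classical in
theorem exponent_mul_letter {μ : NF X} (hμ : μ.IsPair) (y : X) :
    (μ * letter y).exponent = μ.exponent + Pi.single (.inr y) 1 := by
  cases μ with
  | letter x => exact hμ.elim
  | pair u v hu hv =>
    ext (x | x) <;> simp [exponent, pair_mul_letter, Multiset.count_cons, Pi.single_apply]

open scoped Classical in
theorem exponent_letter_mul {μ : NF X} (hμ : μ.IsPair) (z : X) :
    (letter z * μ).exponent = μ.exponent + Pi.single (.inl z) 1 := by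
  cases μ with
  | letter x => exact hμ.elim
  | pair u v hu hv =>
    ext (x | x) <;> simp [exponent, letter_mul_pair, Multiset.count_cons, Pi.single_apply]

theorem exponent_le_exponent {u v u' v' : Multiset X} {hu hv hu' hv'} :
    (pair u v hu hv).exponent ≤ (pair u' v' hu' hv').exponent ↔ u ≤ u' ∧ v ≤ v' := by
  classical
  simp only [exponent, Pi.le_def, Sum.forall, Sum.elim_inl, Sum.elim_inr, Multiset.le_iff_count]

theorem exponent_injOn_isPair : Set.InjOn exponent {μ : NF X | μ.IsPair} := by
  rintro (x | ⟨u, v, hu, hv⟩) hμ (y | ⟨u', v', hu', hv'⟩) hν h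
  · exact hμ.elim
  · exact hμ.elim
  · exact hν.elim
  · obtain ⟨hu, hv⟩ := exponent_le_exponent.1 h.le
    obtain ⟨hu', hv'⟩ := exponent_le_exponent.1 h.ge
    congr
    · exact hu.antisymm hu'
    · exact hv.antisymm hv'

theorem exists_isPair_exponent_eq_iff [Finite X] {d : X ⊕ X → ℕ} :
    (∃ μ : NF X, μ.IsPair ∧ μ.exponent = d) ↔
      (∃ x, d (.inl x) ≠ 0) ∧ ∃ y, d (.inr y) ≠ 0 := by
  classical
  constructor
  · rintro ⟨x | ⟨u, v, hu, hv⟩, hμ, rfl⟩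
    · exact hμ.elim
    · exact ⟨(Multiset.exists_mem_of_ne_zero hu).imp fun _ => Multiset.count_ne_zero.2,
        (Multiset.exists_mem_of_ne_zero hv).imp fun _ => Multiset.count_ne_zero.2⟩
  · rintro ⟨⟨x, hx⟩, y, hy⟩
    let word (f : X → ℕ) : Multiset X := Finsupp.toMultiset (Finsupp.equivFunOnFinite.symm f)
    have count_word (f : X → ℕ) (x : X) : (word f).count x = f x := Finsupp.count_toMultiset _ _
    refine ⟨pair (word (d ∘ .inl)) (word (d ∘ .inr)) ?_ ?_, trivial, ?_⟩
    · exact fun h => hx (by simpa [h] using (count_word (d ∘ .inl) x).symm)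
    · exact fun h => hy (by simpa [h] using (count_word (d ∘ .inr) y).symm)
    · ext (x | x)
      · exact count_word (d ∘ .inl) x
      · exact count_word (d ∘ .inr) x

theorem weight_const (C : ℕ) (μ : NF X) : μ.weight (fun _ => C) = C * μ.length := by
  cases μ with
  | letter x => simp only [weight, length, max_self, mul_one]
  | pair u v hu hv =>
    simp only [weight, length, Function.comp_def, Multiset.map_const', Multiset.sum_replicate,
      smul_eq_mul]
    ring

theorem weight_mono (μ : NF X) : Monotone fun w => μ.weight w := by
  intro w w' h
  cases μ with
  | letter x => exact max_le_max (h _) (h _)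
  | pair u v hu hv =>
    exact add_le_add (Multiset.sum_map_le_sum_map _ _ fun _ _ => h _)
      (Multiset.sum_map_le_sum_map _ _ fun _ _ => h _)

open scoped Classical in
theorem weight_eq_dotProduct [Fintype X] (w : X ⊕ X → ℕ) {μ : NF X} (hμ : μ.IsPair) :
    μ.weight w = w ⬝ᵥ μ.exponent := by
  cases μ with
  | letter x => exact hμ.elim
  | pair u v hu hv =>
    have sum_map (f : X → ℕ) (s : Multiset X) : (s.map f).sum = ∑ x, f x * s.count x := by
      rw [sum_multiset_map_count, sum_subset (subset_univ _)]
      · exact sum_congr rfl fun x _ => mul_comm _ _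
      · exact fun x _ hx => by simp [Multiset.count_eq_zero.2 (mt Multiset.mem_toFinset.2 hx)]
    simp only [weight, sum_map, Function.comp_apply, dotProduct, Fintype.sum_sum_type, exponent,
      Sum.elim_inl, Sum.elim_inr]

theorem weight_mul_letter {μ : NF X} (hμ : μ.IsPair) (w : X ⊕ X → ℕ) (y : X) :
    (μ * letter y).weight w = μ.weight w + w (.inr y) := by
  cases μ with
  | letter x => exact hμ.elim
  | pair u v hu hv =>
    simp only [pair_mul_letter, weight, Multiset.map_cons, Multiset.sum_cons, Function.comp_apply]
    ring

theorem weight_letter_mul {μ : NF X} (hμ : μ.IsPair) (w : X ⊕ X → ℕ) (z : X) :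
    (letter z * μ).weight w = w (.inl z) + μ.weight w := by
  cases μ with
  | letter x => exact hμ.elim
  | pair u v hu hv =>
    simp only [letter_mul_pair, weight, Multiset.map_cons, Multiset.sum_cons, Function.comp_apply]
    ring

theorem weight_letter_mul_letter (w : X ⊕ X → ℕ) (z y : X) :
    (letter z * letter y).weight w = w (.inl z) + w (.inr y) := by
  simp only [letter_mul_letter, weight, Multiset.map_singleton, Multiset.sum_singleton,
    Function.comp_apply]

theorem weight_mul_letter_le (μ : NF X) (w : X ⊕ X → ℕ) (y : X) :
    (μ * letter y).weight w ≤ μ.weight w + w (.inr y) := by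
  cases μ with
  | letter x => grw [weight_letter_mul_letter, weight, ← le_max_left]
  | pair u v hu hv => exact (weight_mul_letter (μ := pair u v hu hv) trivial w y).le

theorem weight_letter_mul_le (μ : NF X) (w : X ⊕ X → ℕ) (z : X) :
    (letter z * μ).weight w ≤ w (.inl z) + μ.weight w := by
  cases μ with
  | letter x => grw [weight_letter_mul_letter, weight, ← le_max_right]
  | pair u v hu hv => exact (weight_letter_mul (μ := pair u v hu hv) trivial w z).le

theorem shift_pair (zs ys : List X) (u v : Multiset X) (hu : u ≠ 0) (hv : v ≠ 0) :
    shift zs ys (pair u v hu hv) = pair (↑zs + u) (v + ↑ys)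
      (fun h => hu (add_eq_zero.1 h).2) fun h => hv (add_eq_zero.1 h).1 := by
  have foldl_pair (v hv) : ys.foldl (fun ν y => ν * letter y) (pair u v hu hv) =
      pair u (v + ↑ys) hu fun h => hv (add_eq_zero.1 h).1 := by
    induction ys generalizing v with
    | nil => simp
    | cons y ys ih => simp [pair_mul_letter, ih, ← Multiset.cons_coe]
  have foldr_pair (v hv) : zs.foldr (fun z ν => letter z * ν) (pair u v hu hv) =
      pair (↑zs + u) v (fun h => hu (add_eq_zero.1 h).2) hv := by
    induction zs with
    | nil => simp
    | cons z zs ih => simp [letter_mul_pair, ih, ← Multiset.cons_coe]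
  rw [shift, foldl_pair, foldr_pair]

theorem exponent_le_exponent_iff_exists_shift_eq {μ ν : NF X} (hμ : μ.IsPair) (hν : ν.IsPair) :
    μ.exponent ≤ ν.exponent ↔ ∃ zs ys, shift zs ys μ = ν := by
  cases μ with
  | letter x => exact hμ.elim
  | pair u v hu hv =>
    cases ν with
    | letter x => exact hν.elim
    | pair u' v' hu' hv' =>
      simp only [exponent_le_exponent, shift_pair, pair.injEq]
      constructor
      · rintro ⟨hu, hv⟩
        obtain ⟨s, rfl⟩ := exists_add_of_le hu
        obtain ⟨t, rfl⟩ := exists_add_of_le hv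
        refine ⟨s.toList, t.toList, ?_⟩
        rw [Multiset.coe_toList, Multiset.coe_toList, add_comm]
        exact ⟨rfl, rfl⟩
      · rintro ⟨zs, ys, rfl, rfl⟩
        exact ⟨Multiset.le_add_left _ _, Multiset.le_add_right _ _⟩

theorem weight_shift {μ : NF X} (hμ : μ.IsPair) (w : X ⊕ X → ℕ) (zs ys : List X) :
    (shift zs ys μ).weight w =
      (zs.map (w ∘ .inl)).sum + (μ.weight w + (ys.map (w ∘ .inr)).sum) := by
  cases μ with
  | letter x => exact hμ.elim
  | pair u v hu hv =>
    simp only [shift_pair, weight, Multiset.map_add, Multiset.sum_add, Multiset.map_coe,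
      Multiset.sum_coe]
    ring

theorem weight_shift_le (μ : NF X) (w : X ⊕ X → ℕ) (zs ys : List X) :
    (shift zs ys μ).weight w ≤
      (zs.map (w ∘ .inl)).sum + (μ.weight w + (ys.map (w ∘ .inr)).sum) := by
  have foldl_le : (ys.foldl (fun ν y => ν * letter y) μ).weight w ≤
      μ.weight w + (ys.map (w ∘ .inr)).sum := by
    induction ys generalizing μ with
    | nil => exact le_rfl
    | cons y ys ih =>
      grw [List.foldl_cons, ih, weight_mul_letter_le, List.map_cons, List.sum_cons, add_assoc]
      rfl
  grw [← foldl_le]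
  induction zs with
  | nil => exact (zero_add _).ge
  | cons z zs ih =>
    grw [shift, List.foldr_cons, weight_letter_mul_le, ← shift, ih, List.map_cons, List.sum_cons,
      add_assoc]
    rfl

end NF

namespace NF

open Finset

variable {X : Type*} [LinearOrder (NF X)]

theorem lt_letter_mul (hord : IsMonomialOrder X) (z : X) (μ : NF X) : μ < letter z * μ := by
  classical
  have not_mul_lt (ν : NF X) : ¬ letter z * ν < ν := by
    induction ν using hord.wf.induction with
    | ind ν ih => exact fun h => ih _ h (hord.mul_lt_mul_left _ _ _ h)
  refine (not_lt.1 (not_mul_lt μ)).lt_of_ne fun h => ?_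
  cases μ with
  | letter x => cases h
  | pair u v hu hv => simpa [← h] using exponent_letter_mul (μ := pair u v hu hv) trivial z

theorem lt_mul_letter (hord : IsMonomialOrder X) (y : X) (μ : NF X) : μ < μ * letter y := by
  classical
  have not_mul_lt (ν : NF X) : ¬ ν * letter y < ν := by
    induction ν using hord.wf.induction with
    | ind ν ih => exact fun h => ih _ h (hord.mul_lt_mul_right _ _ _ h)
  refine (not_lt.1 (not_mul_lt μ)).lt_of_ne fun h => ?_
  cases μ with
  | letter x => cases h
  | pair u v hu hv => simpa [← h] using exponent_mul_letter (μ := pair u v hu hv) trivial y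

theorem shift_strictMono (hord : IsMonomialOrder X) (zs ys : List X) :
    StrictMono (shift zs ys) := by
  have foldl_strictMono : StrictMono fun ν : NF X => ys.foldl (fun μ y => μ * letter y) ν := by
    induction ys with
    | nil => exact strictMono_id
    | cons y ys ih => exact ih.comp fun _ _ => hord.mul_lt_mul_right _ _ _
  have foldr_strictMono : StrictMono fun ν : NF X => zs.foldr (fun z μ => letter z * μ) ν := by
    induction zs with
    | nil => exact strictMono_id
    | cons z zs ih => exact fun _ _ h => hord.mul_lt_mul_left _ _ _ (ih h)
  exact foldr_strictMono.comp foldl_strictMono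

/-- The differences of the exponents of two pairs `p < q`. A monomial order on the pairs is the
order on exponents whose strictly positive elements form this semigroup. -/
def exponentDiffs (hord : IsMonomialOrder X) : AddSubsemigroup (X ⊕ X → ℤ) where
  carrier := {d | ∃ p q : NF X, p.IsPair ∧ q.IsPair ∧ p < q ∧
    d = (fun i => (q.exponent i : ℤ)) - fun i => (p.exponent i : ℤ)}
  add_mem' := by
    rintro _ _ ⟨p, q, hp, hq, hpq, rfl⟩ ⟨p', q', hp', hq', hpq', rfl⟩
    refine ⟨p * p', q * q', isPair_mul _ _, isPair_mul _ _,
      (hord.mul_lt_mul_right _ _ _ hpq).trans (hord.mul_lt_mul_left _ _ _ hpq'), ?_⟩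
    ext i
    simp only [exponent_mul hp hp', exponent_mul hq hq', Pi.add_apply, Pi.sub_apply, Nat.cast_add]
    ring

theorem zero_notMem_exponentDiffs (hord : IsMonomialOrder X) : 0 ∉ exponentDiffs hord := by
  rintro ⟨p, q, hp, hq, hpq, h⟩
  refine hpq.ne (exponent_injOn_isPair hp hq (funext fun i => ?_))
  have := congrFun h i
  simp only [Pi.zero_apply, Pi.sub_apply] at this
  lia

open scoped Classical in
theorem single_mem_exponentDiffs (hord : IsMonomialOrder X) (i : X ⊕ X) :
    Pi.single i 1 ∈ exponentDiffs hord := by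
  rcases i with x | x
  · have hx := isPair_mul (letter x) (letter x)
    refine ⟨_, _, hx, isPair_mul _ _, lt_letter_mul hord x _, ?_⟩
    ext i
    simp [exponent_letter_mul hx, Pi.single_apply]
  · have hx := isPair_mul (letter x) (letter x)
    refine ⟨_, _, hx, isPair_mul _ _, lt_mul_letter hord x _, ?_⟩
    ext i
    simp [exponent_mul_letter hx, Pi.single_apply]

variable [Finite X]

theorem exists_weight_lt_of_isPair (hord : IsMonomialOrder X) (T : Finset (NF X)) :
    ∃ w : X ⊕ X → ℕ, (∀ i, 1 ≤ w i) ∧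
      ∀ p ∈ T, ∀ q ∈ T, p.IsPair → q.IsPair → p < q → p.weight w < q.weight w := by
  classical
  have := Fintype.ofFinite X
  let diff (pq : NF X × NF X) : X ⊕ X → ℤ := fun i => (pq.2.exponent i : ℤ) - pq.1.exponent i
  let D := univ.image (fun i => Pi.single i 1) ∪
    {pq ∈ T ×ˢ T | pq.1.IsPair ∧ pq.2.IsPair ∧ pq.1 < pq.2}.image diff
  have hD : ∀ d ∈ D, d ∈ exponentDiffs hord := by
    simp only [D, mem_union, mem_image, mem_univ, true_and, mem_filter]
    rintro _ (⟨i, rfl⟩ | ⟨⟨p, q⟩, ⟨-, hp, hq, hpq⟩, rfl⟩)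
    · exact single_mem_exponentDiffs hord i
    · exact ⟨p, q, hp, hq, hpq, rfl⟩
  obtain ⟨w, hw⟩ := exists_pos_dotProduct (zero_notMem_exponentDiffs hord) D hD
  have hpos (i) : 0 < w i := by
    simpa using hw _ (mem_union_left _ (mem_image_of_mem _ (mem_univ i)))
  lift w to X ⊕ X → ℕ using fun i => (hpos i).le
  refine ⟨w, fun i => Nat.cast_pos.1 (hpos i), fun p hp q hq hpp hqp hpq => ?_⟩
  have hdiff := hw (diff (p, q)) <| mem_union_right _ <| mem_image_of_mem _ <| mem_filter.2
    ⟨mem_product.2 ⟨hp, hq⟩, hpp, hqp, hpq⟩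
  rw [weight_eq_dotProduct w hpp, weight_eq_dotProduct w hqp]
  zify
  simpa [diff, dotProduct, mul_sub, sum_sub_distrib] using hdiff

theorem exists_weight_lt (hord : IsMonomialOrder X) (T : Finset (NF X)) :
    ∃ w : X ⊕ X → ℕ, (∀ i, 1 ≤ w i) ∧
      ∀ ν ∈ T, ∀ μ ∈ T, μ.IsPair → ν < μ → ν.weight w < μ.weight w := by
  classical
  obtain ⟨w, hw, hlt⟩ := exists_weight_lt_of_isPair hord (T ∪ image₂ (· * ·) T T)
  refine ⟨w, hw, fun ν hν μ hμ hμp hνμ => ?_⟩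
  cases ν with
  | pair u v hu hv => exact hlt _ (mem_union_left _ hν) _ (mem_union_left _ hμ) trivial hμp hνμ
  | letter x =>
    have hlt_mul (a) (ha : a ∈ T) (b) (hb : b ∈ T) (c) (hc : c ∈ T) (d) (hd : d ∈ T)
        (h : a * b < c * d) : (a * b).weight w < (c * d).weight w :=
      hlt _ (mem_union_right _ (mem_image₂_of_mem ha hb)) _
        (mem_union_right _ (mem_image₂_of_mem hc hd)) (isPair_mul _ _) (isPair_mul _ _) h
    have hleft := hlt_mul _ hν _ hν _ hμ _ hν (hord.mul_lt_mul_right _ _ _ hνμ)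
    have hright := hlt_mul _ hν _ hν _ hν _ hμ (hord.mul_lt_mul_left _ _ _ hνμ)
    rw [weight_letter_mul_letter, weight_mul_letter hμp] at hleft
    rw [weight_letter_mul_letter, weight_letter_mul hμp] at hright
    exact max_lt (by lia) (by lia)

end NF

/-! ### Leading monomials of normal `S`-polynomials -/

namespace AlgIdeal

section General

variable {k A : Type*} [Field k] [NonUnitalNonAssocRing A] [Module k A]

theorem subset_span (S : Set A) : S ⊆ (span k S).toSubmodule := by
  refine fun s hs => Submodule.mem_sInf.2 ?_
  rintro _ ⟨I, rfl, hI⟩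
  exact hI hs

theorem proj_eq_zero_iff (I : AlgIdeal k A) {a : A} : I.proj a = 0 ↔ a ∈ I.toSubmodule :=
  Submodule.Quotient.mk_eq_zero _

end General

theorem rNormed_lNormed_mem {k X : Type*} [Field k] (I : AlgIdeal k (BC k X)) {f : BC k X}
    (hf : f ∈ I.toSubmodule) (zs ys : List X) : rNormed zs (lNormed f ys) ∈ I.toSubmodule := by
  have lNormed_mem : lNormed f ys ∈ I.toSubmodule := by
    induction ys generalizing f with
    | nil => exact hf
    | cons y _ ih => exact ih (I.mul_mem_right _ _ hf)
  induction zs with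
  | nil => exact lNormed_mem
  | cons z zs ih => exact I.mul_mem_left _ _ ih

end AlgIdeal

section LeadingMonomials

open MonoidAlgebra (mapDomain mapDomain_add mapDomain_single)

variable {k X : Type*} [Field k]

theorem rNormed_lNormed_single (zs ys : List X) (μ : NF X) (a : k) :
    rNormed zs (lNormed (MonoidAlgebra.single μ a) ys) =
      MonoidAlgebra.single (NF.shift zs ys μ) a := by
  have lNormed_single : lNormed (MonoidAlgebra.single μ a) ys =
      MonoidAlgebra.single (ys.foldl (fun ν y => ν * NF.letter y) μ) a := by
    induction ys generalizing μ with
    | nil => rfl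
    | cons y ys ih => simpa [lNormed, BC.of] using ih (μ * NF.letter y)
  rw [lNormed_single, NF.shift]
  induction zs with
  | nil => rfl
  | cons z zs ih => simpa [rNormed, BC.of] using congrArg (BC.of k z * ·) ih

theorem rNormed_lNormed_add (zs ys : List X) (f g : BC k X) :
    rNormed zs (lNormed (f + g) ys) = rNormed zs (lNormed f ys) + rNormed zs (lNormed g ys) := by
  have lNormed_add : lNormed (f + g) ys = lNormed f ys + lNormed g ys := by
    induction ys generalizing f g with
    | nil => rfl
    | cons y ys ih => simpa [lNormed, add_mul] using ih (f * BC.of k y) (g * BC.of k y)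
  rw [lNormed_add]
  induction zs with
  | nil => rfl
  | cons z zs ih => simpa [rNormed, mul_add] using congrArg (BC.of k z * ·) ih

theorem rNormed_lNormed_eq_mapDomain (zs ys : List X) (f : BC k X) :
    rNormed zs (lNormed f ys) = mapDomain (NF.shift zs ys) f := by
  induction f using MonoidAlgebra.induction_linear with
  | zero => simpa using rNormed_lNormed_add zs ys (0 : BC k X) 0
  | add f g hf hg => rw [rNormed_lNormed_add, mapDomain_add, hf, hg]
  | single μ a => rw [rNormed_lNormed_single, mapDomain_single]

variable [LinearOrder (NF X)]

theorem leadMon_eq_coe_iff {f : BC k X} {μ : NF X} :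
    leadMon f = μ ↔ μ ∈ f.coeff.support ∧ ∀ ν ∈ f.coeff.support, ν ≤ μ := by
  refine ⟨fun h => ⟨Finset.mem_of_max h, fun ν hν => Finset.le_max_of_eq hν h⟩, fun h => ?_⟩
  exact le_antisymm (Finset.max_le fun ν hν => WithBot.coe_le_coe.2 (h.2 ν hν)) (Finset.le_max h.1)

theorem exists_leadMon_eq {f : BC k X} (hf : f ≠ 0) : ∃ μ : NF X, leadMon f = μ :=
  Finset.max_of_nonempty (Finsupp.support_nonempty_iff.2 (by simpa using hf))

theorem coeff_rNormed_lNormed (hord : IsMonomialOrder X) (zs ys : List X) (f : BC k X)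
    (μ : NF X) : (rNormed zs (lNormed f ys)).coeff (NF.shift zs ys μ) = f.coeff μ := by
  rw [rNormed_lNormed_eq_mapDomain]
  exact Finsupp.mapDomain_apply (NF.shift_strictMono hord zs ys).injective _ _

theorem support_rNormed_lNormed (hord : IsMonomialOrder X) (zs ys : List X) (f : BC k X) :
    (rNormed zs (lNormed f ys)).coeff.support = f.coeff.support.image (NF.shift zs ys) := by
  rw [rNormed_lNormed_eq_mapDomain]
  exact Finsupp.mapDomain_support_of_injective (NF.shift_strictMono hord zs ys).injective _

theorem leadMon_rNormed_lNormed (hord : IsMonomialOrder X) (zs ys : List X) {f : BC k X}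
    {μ : NF X} (h : leadMon f = μ) :
    leadMon (rNormed zs (lNormed f ys)) = (NF.shift zs ys μ : WithBot (NF X)) := by
  rw [leadMon_eq_coe_iff] at h ⊢
  simp only [support_rNormed_lNormed hord, Finset.forall_mem_image]
  exact ⟨Finset.mem_image_of_mem _ h.1,
    fun ν hν => (NF.shift_strictMono hord zs ys).monotone (h.2 ν hν)⟩

/-- The leading monomials of the elements of `S` that are not letters. -/
def leadPairs (S : Set (BC k X)) : Set (NF X) := {μ | μ.IsPair ∧ ∃ s ∈ S, leadMon s = μ}

theorem coe_image_leadPairs_subset (S : Set (BC k X)) :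
    ((↑) : NF X → WithBot (NF X)) '' leadPairs S ⊆ leadMon '' S := by
  rintro _ ⟨_, ⟨-, s, hs, hμ⟩, rfl⟩
  exact ⟨s, hs, hμ⟩

theorem finite_leadPairs {S : Set (BC k X)} (hS : S.Finite) : (leadPairs S).Finite :=
  ((hS.image leadMon).subset (coe_image_leadPairs_subset S)).of_finite_image
    WithBot.coe_injective.injOn

theorem ncard_leadPairs_le {S : Set (BC k X)} (hS : S.Finite) :
    (leadPairs S).ncard ≤ S.ncard := by
  rw [← Set.ncard_image_of_injective (leadPairs S) WithBot.coe_injective]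
  exact (Set.ncard_le_ncard (coe_image_leadPairs_subset S) (hS.image _)).trans
    (Set.ncard_image_le hS)

theorem IsNormalPoly.exists_leadPairs_exponent_le (hord : IsMonomialOrder X) {S : Set (BC k X)}
    {h : BC k X} (hh : IsNormalPoly S h) {μ : NF X} (hμ : μ.IsPair) (hlead : leadMon h = μ) :
    ∃ ν ∈ leadPairs S, ν.exponent ≤ μ.exponent := by
  cases hh with
  | base _ hs => exact ⟨μ, ⟨hμ, h, hs, hlead⟩, le_rfl⟩
  | extend s hs ν hν hl zs ys =>
    have hνp := NF.two_le_length_iff_isPair.1 hl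
    rw [leadMon_rNormed_lNormed hord zs ys hν, WithBot.coe_inj] at hlead
    exact ⟨ν, ⟨hνp, s, hs, hν⟩,
      (NF.exponent_le_exponent_iff_exists_shift_eq hνp hμ).2 ⟨zs, ys, hlead⟩⟩

theorem IsGSBasis.exists_leadPairs_exponent_le (hord : IsMonomialOrder X) {S : Set (BC k X)}
    (hS : IsGSBasis S) {f : BC k X} (hf : f ∈ (AlgIdeal.span k S).toSubmodule) {μ : NF X}
    (hμ : μ.IsPair) (hlead : leadMon f = μ) : ∃ ν ∈ leadPairs S, ν.exponent ≤ μ.exponent := by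
  have hf0 : f ≠ 0 := by
    rintro rfl
    simpa using (leadMon_eq_coe_iff.1 hlead).1
  obtain ⟨h, hh, hfh⟩ := hS.lead f hf hf0
  exact hh.exists_leadPairs_exponent_le hord hμ (hfh.symm.trans hlead)

theorem IsGSBasis.leadPairs_nonempty [Nonempty X] (hord : IsMonomialOrder X) {S : Set (BC k X)}
    (hS : IsGSBasis S) (hne : S.Nonempty) : (leadPairs S).Nonempty := by
  obtain ⟨s, hs⟩ := hne
  obtain ⟨μ, hμ, -⟩ := hS.monic s hs
  obtain ⟨y⟩ := ‹Nonempty X›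
  obtain ⟨ν, hν, -⟩ := hS.exists_leadPairs_exponent_le hord
    (AlgIdeal.rNormed_lNormed_mem _ (AlgIdeal.subset_span S hs) [] [y])
    (NF.isPair_mul μ (.letter y))
    (leadMon_rNormed_lNormed hord [] [y] hμ)
  exact ⟨ν, hν⟩

end LeadingMonomials

/-! ### Growth and Gelfand–Kirillov dimension -/

section GKDimBounds

open Filter Asymptotics Topology

theorem tendsto_logb_mul_pow {C : ℝ} (hC : C ≠ 0) (m : ℕ) :
    Tendsto (fun n : ℕ => ((Real.logb n (C * n ^ m) : ℝ) : EReal)) atTop (𝓝 m) := by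
  have logb_const : Tendsto (fun n : ℕ => Real.logb n C + m) atTop (𝓝 m) := by
    simpa [Real.logb] using ((Real.tendsto_log_atTop.comp
      tendsto_natCast_atTop_atTop).const_div_atTop (Real.log C)).add_const (m : ℝ)
  refine (continuous_coe_real_ereal.tendsto (m : ℝ)).comp (logb_const.congr' ?_)
  filter_upwards [eventually_gt_atTop 1] with n hn
  have hn' : (1 : ℝ) < n := Nat.one_lt_cast.2 hn
  rw [Real.logb_mul hC (by positivity), Real.logb_pow, Real.logb_self_eq_one hn', mul_one]

theorem limsup_logb_le {a : ℕ → ℕ} {m : ℕ}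
    (h : (fun n => (a n : ℝ)) =O[atTop] fun n : ℕ => (n : ℝ) ^ m) :
    limsup (fun n : ℕ => ((Real.logb n (a n) : ℝ) : EReal)) atTop ≤ m := by
  obtain ⟨C, hC⟩ := h.bound
  rw [← (tendsto_logb_mul_pow (C := max C 1) (by positivity) m).limsup_eq]
  refine limsup_le_limsup ?_
  filter_upwards [eventually_gt_atTop 1, hC] with n hn hle
  have hn' : (1 : ℝ) < n := Nat.one_lt_cast.2 hn
  rw [EReal.coe_le_coe_iff]
  rcases (a n).eq_zero_or_pos with h0 | hpos
  · rw [h0, Nat.cast_zero, Real.logb_zero]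
    exact Real.logb_nonneg hn' (one_le_mul_of_one_le_of_one_le (le_max_right _ _)
      (one_le_pow₀ hn'.le))
  · refine Real.logb_le_logb_of_le hn' (Nat.cast_pos.2 hpos) ?_
    simp only [norm_pow, Real.norm_natCast] at hle
    exact hle.trans (by gcongr; exact le_max_left _ _)

theorem le_limsup_logb {a : ℕ → ℕ} {m : ℕ}
    (h : (fun n : ℕ => (n : ℝ) ^ m) =O[atTop] fun n => (a n : ℝ)) :
    (m : EReal) ≤ limsup (fun n : ℕ => ((Real.logb n (a n) : ℝ) : EReal)) atTop := by
  obtain ⟨C, hC, hle⟩ := h.exists_pos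
  rw [← (tendsto_logb_mul_pow (inv_ne_zero hC.ne') m).limsup_eq]
  refine limsup_le_limsup ?_
  filter_upwards [eventually_gt_atTop 1, hle.bound] with n hn hle
  rw [EReal.coe_le_coe_iff]
  refine Real.logb_le_logb_of_le (Nat.one_lt_cast.2 hn) (by positivity) ?_
  rw [inv_mul_le_iff₀ hC]
  simpa using hle

theorem isBigO_pow_comp_mul {f : ℕ → ℝ} {m C : ℕ}
    (hf : f =O[atTop] fun n : ℕ => (n : ℝ) ^ m) (hC : C ≠ 0) :
    (fun n => f (C * n)) =O[atTop] fun n : ℕ => (n : ℝ) ^ m := by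
  refine (hf.comp_tendsto (tendsto_id.const_mul_atTop' (Nat.pos_of_ne_zero hC))).trans ?_
  simpa [Function.comp_def, mul_pow] using
    (isBigO_refl (fun n : ℕ => (n : ℝ) ^ m) atTop).const_mul_left ((C : ℝ) ^ m)

variable {k A : Type*} [Field k] [NonUnitalNonAssocRing A] [Module k A]

theorem gkDim_nonneg : 0 ≤ gkDim k A := by
  refine le_iSup_of_le ⟨⊥, inferInstance⟩ ?_
  refine (limsup_const (0 : EReal)).ge.trans (limsup_le_limsup (.of_forall fun n => ?_))
  exact EReal.coe_nonneg.2 (div_nonneg (Real.log_natCast_nonneg _) (Real.log_natCast_nonneg _))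

/-- An exhaustive filtration of an algebra by finite-dimensional subspaces, compatible with the
multiplication and generated by its first term. The growth of such a filtration determines the
Gelfand–Kirillov dimension. -/
structure IsGeneratingFiltration (F : ℕ → Submodule k A) : Prop where
  mono : Monotone F
  exists_mem : ∀ a, ∃ n, a ∈ F n
  finiteDimensional : ∀ n, FiniteDimensional k (F n)
  mul_mem : ∀ {m n a b}, a ∈ F m → b ∈ F n → a * b ∈ F (m + n)
  le_subPowLE : ∀ n, F n ≤ subPowLE (F 1) n

namespace IsGeneratingFiltration

variable {F : ℕ → Submodule k A}

theorem exists_le (hF : IsGeneratingFiltration F) (V : Submodule k A) [FiniteDimensional k V] :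
    ∃ d, V ≤ F d := by
  obtain ⟨t, ht⟩ := (Submodule.fg_iff_finiteDimensional V).2 ‹_›
  choose d hd using hF.exists_mem
  refine ⟨t.sup d, ht ▸ Submodule.span_le.2 fun a ha => ?_⟩
  exact hF.mono (Finset.le_sup (f := d) ha) (hd a)

theorem subPow_le (hF : IsGeneratingFiltration F) {V : Submodule k A} {d : ℕ} (hV : V ≤ F d)
    (n : ℕ) : subPow V n ≤ F (d * n) := by
  induction n using subPow.induct with
  | case1 => simp [subPow]
  | case2 => simpa [subPow] using hV
  | case3 n ihl ihr =>
    rw [subPow]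
    refine iSup_le fun i => Submodule.span_le.2 ?_
    rintro _ ⟨a, ha, b, hb, rfl⟩
    have hmul := hF.mul_mem (ihl i ha) (ihr i hb)
    rwa [← mul_add, show (i : ℕ) + 1 + (n + 1 - i) = n + 2 by lia] at hmul

theorem subPowLE_le (hF : IsGeneratingFiltration F) {V : Submodule k A} {d : ℕ} (hV : V ≤ F d)
    (n : ℕ) : subPowLE V n ≤ F (d * n) :=
  iSup₂_le fun i hi => (hF.subPow_le hV i).trans
    (hF.mono (Nat.mul_le_mul_left d (Finset.mem_Icc.1 hi).2))

theorem gkDim_le (hF : IsGeneratingFiltration F) {m : ℕ}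
    (h : (fun n => (Module.finrank k (F n) : ℝ)) =O[atTop] fun n : ℕ => (n : ℝ) ^ m) :
    gkDim k A ≤ m := by
  refine iSup_le fun ⟨V, hV⟩ => limsup_logb_le ?_
  obtain ⟨d, hd⟩ := hF.exists_le V
  have hd' : V ≤ F (d + 1) := hd.trans (hF.mono d.le_succ)
  refine IsBigO.trans (.of_norm_le fun n => ?_) (isBigO_pow_comp_mul h d.succ_ne_zero)
  have := hF.finiteDimensional ((d + 1) * n)
  rw [Real.norm_natCast, Nat.cast_le]
  exact Submodule.finrank_mono (hF.subPowLE_le hd' n)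

theorem le_gkDim (hF : IsGeneratingFiltration F) {m : ℕ}
    (h : (fun n : ℕ => (n : ℝ) ^ m) =O[atTop] fun n => (Module.finrank k (F n) : ℝ)) :
    (m : EReal) ≤ gkDim k A := by
  refine le_iSup_of_le ⟨F 1, hF.finiteDimensional 1⟩ (le_limsup_logb (h.congr_right fun n => ?_))
  have hle := hF.subPowLE_le (le_refl (F 1)) n
  rw [one_mul] at hle
  rw [(hF.le_subPowLE n).antisymm hle]

end IsGeneratingFiltration

end GKDimBounds

/-! ### Monomials in quotients of `BC(X)` -/

namespace NF

variable {X : Type*}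

theorem one_le_length (μ : NF X) : 1 ≤ μ.length := by
  by_cases hμ : μ.IsPair
  · exact one_le_two.trans (two_le_length_iff_isPair.2 hμ)
  · cases μ with
    | letter x => exact le_rfl
    | pair u v hu hv => exact (hμ trivial).elim

theorem length_mul (μ ν : NF X) : (μ * ν).length = μ.length + ν.length := by
  cases μ <;> cases ν <;>
    simp only [letter_mul_letter, letter_mul_pair, pair_mul_letter, pair_mul_pair, length,
      Multiset.card_cons, Multiset.card_add, Multiset.card_singleton] <;> ring

theorem length_eq_sum_exponent [Fintype X] {μ : NF X} (hμ : μ.IsPair) :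
    μ.length = ∑ i, μ.exponent i := by
  rw [← one_mul μ.length, ← weight_const, weight_eq_dotProduct _ hμ]
  simp only [dotProduct, one_mul]

@[elab_as_elim]
theorem mul_induction {motive : NF X → Prop} (letter : ∀ x, motive (letter x))
    (mul : ∀ μ ν, motive μ → motive ν → motive (μ * ν)) (μ : NF X) : motive μ := by
  cases μ with
  | letter x => exact letter x
  | pair u v hu hv =>
    obtain ⟨a, t, rfl⟩ := exists_eq_cons hu
    obtain ⟨b, s, rfl⟩ := exists_eq_cons hv
    induction t using Multiset.induction generalizing a with
    | empty =>
      induction s using Multiset.induction generalizing b with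
      | empty => exact mul _ _ (letter a) (letter b)
      | cons c s ih => exact mul _ _ (ih c Multiset.cons_ne_zero) (letter b)
    | cons c t ih => exact mul _ _ (letter a) (ih c Multiset.cons_ne_zero)

theorem growth_exponent_image [Fintype X] {T : Set (NF X)} (hT : ∀ μ ∈ T, μ.IsPair) (n : ℕ) :
    growth (exponent '' T) n = {μ ∈ T | μ.length ≤ n}.ncard := by
  have image_eq : {d ∈ exponent '' T | ∑ i, d i ≤ n} = exponent '' {μ ∈ T | μ.length ≤ n} := by
    ext d
    constructor
    · rintro ⟨⟨μ, hμ, rfl⟩, hn⟩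
      exact ⟨μ, ⟨hμ, (length_eq_sum_exponent (hT μ hμ)).trans_le hn⟩, rfl⟩
    · rintro ⟨μ, ⟨hμ, hn⟩, rfl⟩
      exact ⟨⟨μ, hμ, rfl⟩, (length_eq_sum_exponent (hT μ hμ)).symm.trans_le hn⟩
  rw [growth, image_eq]
  exact (exponent_injOn_isPair.mono fun μ hμ => hT μ hμ.1).ncard_image

theorem finite_length_le [Finite X] (n : ℕ) : {μ : NF X | μ.length ≤ n}.Finite := by
  have := Fintype.ofFinite X
  have finite_pairs : {μ : NF X | μ.IsPair ∧ μ.length ≤ n}.Finite := by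
    refine .of_finite_image ((finite_setOf_mem_and_sum_le Set.univ n).subset ?_)
      (exponent_injOn_isPair.mono fun μ hμ => hμ.1)
    rintro _ ⟨μ, ⟨hμ, hn⟩, rfl⟩
    exact ⟨trivial, (length_eq_sum_exponent hμ).symm.trans_le hn⟩
  refine ((Set.finite_range letter).union finite_pairs).subset fun μ hμ => ?_
  cases μ with
  | letter x => exact .inl ⟨x, rfl⟩
  | pair u v hu hv => exact Set.mem_union_right _ ⟨trivial, hμ⟩

end NF

theorem mul_mem_subPow {k A : Type*} [Field k] [NonUnitalNonAssocRing A] [Module k A]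
    {V : Submodule k A} {m n : ℕ} (hm : 1 ≤ m) (hn : 1 ≤ n) {x y : A} (hx : x ∈ subPow V m)
    (hy : y ∈ subPow V n) : x * y ∈ subPow V (m + n) := by
  obtain ⟨m, rfl⟩ := Nat.exists_eq_add_of_le' hm
  obtain ⟨n, rfl⟩ := Nat.exists_eq_add_of_le' hn
  rw [show m + 1 + (n + 1) = m + n + 2 by lia, subPow]
  refine Submodule.mem_iSup_of_mem (⟨m, by lia⟩ : Fin (m + n + 1))
    (Submodule.subset_span ⟨x, hx, y, ?_, rfl⟩)
  rwa [show m + n + 1 - m = n + 1 by lia]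

section MonomialSpans

variable {k X : Type*} [Field k] (I : AlgIdeal k (BC k X))

/-- The image of a normal form in `BC(X) / I`. -/
def monomial (μ : NF X) : I.Quotient := I.proj (MonoidAlgebra.single μ 1)

theorem monomial_mul (μ ν : NF X) : monomial I (μ * ν) = monomial I μ * monomial I ν := by
  rw [monomial, monomial, monomial, ← AlgIdeal.proj_mul, MonoidAlgebra.single_mul_single, one_mul]

theorem proj_mem_of_forall_monomial_mem {U : Submodule k I.Quotient} {f : BC k X}
    (h : ∀ μ ∈ f.coeff.support, monomial I μ ∈ U) : I.proj f ∈ U := by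
  rw [← MonoidAlgebra.sum_coeff_single f, Finsupp.sum, map_sum]
  refine U.sum_mem fun μ hμ => ?_
  rw [← mul_one (f.coeff μ), ← smul_eq_mul, ← MonoidAlgebra.smul_single, map_smul]
  exact U.smul_mem _ (h μ hμ)

/-- The subspace of `BC(X) / I` spanned by the images of a set of normal forms. -/
def monomialSpan (T : Set (NF X)) : Submodule k I.Quotient :=
  Submodule.span k (monomial I '' T)

theorem monomial_mem_monomialSpan {T : Set (NF X)} {μ : NF X} (hμ : μ ∈ T) :
    monomial I μ ∈ monomialSpan I T :=
  Submodule.subset_span ⟨μ, hμ, rfl⟩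

theorem monomialSpan_le {T : Set (NF X)} {U : Submodule k I.Quotient} :
    monomialSpan I T ≤ U ↔ ∀ μ ∈ T, monomial I μ ∈ U := by
  rw [monomialSpan, Submodule.span_le, Set.image_subset_iff]
  rfl

theorem finiteDimensional_monomialSpan {T : Set (NF X)} (hT : T.Finite) :
    FiniteDimensional k (monomialSpan I T) :=
  FiniteDimensional.span_of_finite k (hT.image _)

theorem finrank_monomialSpan_le {T : Set (NF X)} (hT : T.Finite) :
    Module.finrank k (monomialSpan I T) ≤ T.ncard := by
  classical
  refine le_trans ?_ (Set.ncard_image_le (f := monomial I) hT)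
  rw [monomialSpan, ← (hT.image _).coe_toFinset, Set.ncard_coe_finset]
  exact finrank_span_finset_le_card _

theorem mul_mem_monomialSpan {T T' U : Set (NF X)} (h : ∀ μ ∈ T, ∀ ν ∈ T', μ * ν ∈ U)
    {x y : I.Quotient} (hx : x ∈ monomialSpan I T) (hy : y ∈ monomialSpan I T') :
    x * y ∈ monomialSpan I U := by
  induction hx, hy using Submodule.span_induction₂ with
  | mem_mem x y hx hy =>
    obtain ⟨μ, hμ, rfl⟩ := hx
    obtain ⟨ν, hν, rfl⟩ := hy
    rw [← monomial_mul]
    exact monomial_mem_monomialSpan I (h μ hμ ν hν)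
  | zero_left => simp only [zero_mul, zero_mem]
  | zero_right => simp only [mul_zero, zero_mem]
  | add_left x x' y _ _ _ hx hx' => rw [add_mul]; exact add_mem hx hx'
  | add_right x y y' _ _ _ hy hy' => rw [mul_add]; exact add_mem hy hy'
  | smul_left c x y _ _ h => rw [smul_mul_assoc]; exact Submodule.smul_mem _ c h
  | smul_right c x y _ _ h => rw [mul_smul_comm]; exact Submodule.smul_mem _ c h

theorem monomial_mem_subPow (μ : NF X) :
    monomial I μ ∈ subPow (monomialSpan I {ν | ν.length ≤ 1}) μ.length := by
  induction μ using NF.mul_induction with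
  | letter x =>
    rw [NF.length, subPow]
    exact monomial_mem_monomialSpan I (le_refl 1)
  | mul μ ν hμ hν =>
    rw [monomial_mul, NF.length_mul]
    exact mul_mem_subPow μ.one_le_length ν.one_le_length hμ hν

theorem isGeneratingFiltration_length [Finite X] :
    IsGeneratingFiltration fun n => monomialSpan I {μ | μ.length ≤ n} where
  mono m n hmn := (monomialSpan_le I).2 fun μ hμ =>
    monomial_mem_monomialSpan I (le_trans hμ hmn)
  exists_mem a := by
    obtain ⟨f, rfl⟩ := I.proj_surjective a
    exact ⟨f.coeff.support.sup NF.length, proj_mem_of_forall_monomial_mem I fun μ hμ =>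
      monomial_mem_monomialSpan I (Finset.le_sup (f := NF.length) hμ)⟩
  finiteDimensional n := finiteDimensional_monomialSpan I (NF.finite_length_le n)
  mul_mem ha hb := by
    refine mul_mem_monomialSpan I (fun μ hμ ν hν => ?_) ha hb
    exact (NF.length_mul μ ν).trans_le (add_le_add hμ hν)
  le_subPowLE n := (monomialSpan_le I).2 fun μ hμ =>
    Submodule.mem_iSup_of_mem μ.length (Submodule.mem_iSup_of_mem
      (Finset.mem_Icc.2 ⟨μ.one_le_length, hμ⟩) (monomial_mem_subPow I μ))

end MonomialSpans

/-! ### Standard pairs -/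

section StandardPairs

variable {X : Type*}

/-- The normal forms `[u; v]` that are not divisible by any element of `L`. -/
def standardPairs (L : Set (NF X)) : Set (NF X) :=
  {μ | μ.IsPair ∧ ∀ ν ∈ L, ¬ ν.exponent ≤ μ.exponent}

theorem mem_exponent_image_standardPairs [Finite X] {L : Set (NF X)} {d : X ⊕ X → ℕ} :
    d ∈ NF.exponent '' standardPairs L ↔
      ((∃ x, d (.inl x) ≠ 0) ∧ ∃ y, d (.inr y) ≠ 0) ∧ ∀ ν ∈ L, ¬ ν.exponent ≤ d := by
  rw [← NF.exists_isPair_exponent_eq_iff]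
  constructor
  · rintro ⟨μ, ⟨hμ, hL⟩, rfl⟩
    exact ⟨⟨μ, hμ, rfl⟩, hL⟩
  · rintro ⟨⟨μ, hμ, rfl⟩, hL⟩
    exact ⟨μ, ⟨hμ, hL⟩, rfl⟩

theorem exists_isTruncationInvariant_standardPairs [Finite X] {L : Set (NF X)} (hL : L.Finite) :
    ∃ K, IsTruncationInvariant (NF.exponent '' standardPairs L) K := by
  obtain ⟨b, hb⟩ := (hL.image NF.exponent).bddAbove
  obtain ⟨K, hK⟩ := (Set.finite_range b).bddAbove
  have exponent_le : ∀ ν ∈ L, ∀ i, ν.exponent i ≤ K := fun ν hν i =>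
    (hb ⟨ν, hν, rfl⟩ i).trans (hK ⟨i, rfl⟩)
  refine ⟨K + 1, fun d d' h hd => ?_⟩
  rw [mem_exponent_image_standardPairs] at hd ⊢
  obtain ⟨⟨⟨x, hx⟩, y, hy⟩, hd⟩ := hd
  refine ⟨⟨⟨x, ?_⟩, y, ?_⟩, fun ν hν hle => hd ν hν fun i => ?_⟩
  · grind [h (.inl x)]
  · grind [h (.inr y)]
  · grind [h i, hle i, exponent_le ν hν i]

end StandardPairs

section Dimension

open Filter Asymptotics

variable {k X : Type*} [Field k] [LinearOrder (NF X)]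

section LowerBound

variable {S : Set (BC k X)}

theorem IsGSBasis.linearIndependent_monomial (hord : IsMonomialOrder X) (hS : IsGSBasis S) :
    LinearIndependent k fun μ : standardPairs (leadPairs S) =>
      monomial (AlgIdeal.span k S) μ := by
  have linearIndependent_single : LinearIndependent k
      fun μ : standardPairs (leadPairs S) => (MonoidAlgebra.single (μ : NF X) 1 : BC k X) := by
    simpa only [Function.comp_def, MonoidAlgebra.basis_apply] using
      (MonoidAlgebra.basis (NF X) k).linearIndependent.comp
        (Subtype.val : standardPairs (leadPairs S) → NF X) Subtype.val_injective
  refine linearIndependent_single.map (f := (AlgIdeal.span k S).proj)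
    (Submodule.disjoint_def.2 fun f hf hker => ?_)
  by_contra hf0
  have hsupp : f ∈ MonoidAlgebra.supported k k (standardPairs (leadPairs S)) := by
    rwa [MonoidAlgebra.supported_eq_span_single, Set.image_eq_range]
  obtain ⟨μ, hμ⟩ := exists_leadMon_eq hf0
  obtain ⟨hμp, hstd⟩ := MonoidAlgebra.mem_supported.1 hsupp (leadMon_eq_coe_iff.1 hμ).1
  obtain ⟨ν, hν, hle⟩ := hS.exists_leadPairs_exponent_le hord
    ((AlgIdeal.proj_eq_zero_iff _).1 hker) hμp hμ
  exact hstd ν hν hle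

theorem IsGSBasis.ncard_le_finrank (hord : IsMonomialOrder X) (hS : IsGSBasis S) {T : Set (NF X)}
    (hT : T.Finite) : {μ ∈ standardPairs (leadPairs S) | μ ∈ T}.ncard ≤
      Module.finrank k (monomialSpan (AlgIdeal.span k S) T) := by
  have := (hT.subset fun μ (hμ : μ ∈ {μ ∈ standardPairs (leadPairs S) | μ ∈ T}) => hμ.2).fintype
  have := finiteDimensional_monomialSpan (AlgIdeal.span k S) hT
  have hli := (hS.linearIndependent_monomial hord).comp
    (Set.inclusion (Set.sep_subset _ (· ∈ T))) (Set.inclusion_injective _)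
  rw [← Nat.card_coe_set_eq, Nat.card_eq_fintype_card, ← finrank_span_eq_card hli]
  refine Submodule.finrank_mono (Submodule.span_le.2 ?_)
  rintro _ ⟨μ, rfl⟩
  exact monomial_mem_monomialSpan _ μ.2.2

end LowerBound

section UpperBound

/-- A leading monomial of an element of `S`, unless it is a letter, is a heaviest monomial of this
element. Reduction modulo `S` then does not increase weights, whereas it may increase lengths. -/
def IsLeadingWeight (S : Set (BC k X)) (w : X ⊕ X → ℕ) : Prop :=
  ∀ s ∈ S, ∀ μ : NF X, μ.IsPair → leadMon s = μ → ∀ ν ∈ s.coeff.support, ν.weight w ≤ μ.weight w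

theorem exists_isLeadingWeight [Finite X] (hord : IsMonomialOrder X) {S : Set (BC k X)}
    (hS : S.Finite) : ∃ w : X ⊕ X → ℕ, (∀ i, 1 ≤ w i) ∧ IsLeadingWeight S w := by
  classical
  obtain ⟨w, hw1, hw⟩ := NF.exists_weight_lt hord (hS.toFinset.biUnion fun s => s.coeff.support)
  refine ⟨w, hw1, fun s hs μ hμp hμ ν hν => ?_⟩
  have mem_biUnion : ∀ ρ ∈ s.coeff.support, ρ ∈ hS.toFinset.biUnion fun s => s.coeff.support :=
    fun ρ hρ => Finset.mem_biUnion.2 ⟨s, hS.mem_toFinset.2 hs, hρ⟩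
  obtain ⟨hμs, hmax⟩ := leadMon_eq_coe_iff.1 hμ
  rcases (hmax ν hν).eq_or_lt with rfl | hlt
  · exact le_rfl
  · exact (hw ν (mem_biUnion ν hν) μ (mem_biUnion μ hμs) hμp hlt).le

variable {S : Set (BC k X)} {w : X ⊕ X → ℕ}

theorem IsLeadingWeight.exists_reducer (hw : IsLeadingWeight S w) (hord : IsMonomialOrder X)
    (hS : ∀ s ∈ S, IsMonic s) {μ ν : NF X} (hμ : μ.IsPair) (hν : ν ∈ leadPairs S)
    (hle : ν.exponent ≤ μ.exponent) :
    ∃ g ∈ (AlgIdeal.span k S).toSubmodule, g.coeff μ = 1 ∧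
      ∀ ρ ∈ g.coeff.support, ρ ≠ μ → ρ < μ ∧ ρ.weight w ≤ μ.weight w := by
  obtain ⟨hνp, s, hs, hlead⟩ := hν
  obtain ⟨zs, ys, rfl⟩ := (NF.exponent_le_exponent_iff_exists_shift_eq hνp hμ).1 hle
  refine ⟨_, AlgIdeal.rNormed_lNormed_mem _ (AlgIdeal.subset_span S hs) zs ys, ?_,
    fun ρ hρ hne => ⟨?_, ?_⟩⟩
  · obtain ⟨ν', hν', hcoeff⟩ := hS s hs
    rw [hlead, WithBot.coe_inj] at hν'
    rw [coeff_rNormed_lNormed hord, hν', hcoeff]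
  · exact ((leadMon_eq_coe_iff.1 (leadMon_rNormed_lNormed hord zs ys hlead)).2 ρ hρ).lt_of_ne hne
  · rw [support_rNormed_lNormed hord] at hρ
    obtain ⟨τ, hτ, rfl⟩ := Finset.mem_image.1 hρ
    rw [NF.weight_shift hνp]
    refine (NF.weight_shift_le τ w zs ys).trans ?_
    gcongr
    exact hw s hs ν hνp hlead τ hτ

theorem IsLeadingWeight.monomial_mem (hw : IsLeadingWeight S w) (hord : IsMonomialOrder X)
    (hS : ∀ s ∈ S, IsMonic s) {N : ℕ} {μ : NF X} (hμ : μ.weight w ≤ N) :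
    monomial (AlgIdeal.span k S) μ ∈ monomialSpan (AlgIdeal.span k S)
      (Set.range NF.letter ∪ {ν ∈ standardPairs (leadPairs S) | ν.weight w ≤ N}) := by
  induction μ using hord.wf.induction with
  | ind μ ih =>
    by_cases hμp : μ.IsPair
    swap
    · cases μ with
      | letter x => exact monomial_mem_monomialSpan _ (.inl ⟨x, rfl⟩)
      | pair u v hu hv => exact (hμp trivial).elim
    by_cases hstd : μ ∈ standardPairs (leadPairs S)
    · exact monomial_mem_monomialSpan _ (.inr ⟨hstd, hμ⟩)
    obtain ⟨ν, hν, hle⟩ : ∃ ν ∈ leadPairs S, ν.exponent ≤ μ.exponent := by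
      simpa [standardPairs, hμp] using hstd
    obtain ⟨g, hg, hgμ, hlow⟩ := hw.exists_reducer hord hS hμp hν hle
    have proj_eq : monomial (AlgIdeal.span k S) μ =
        -(AlgIdeal.span k S).proj (MonoidAlgebra.erase μ g) := by
      rw [eq_neg_iff_add_eq_zero, monomial, ← map_add, AlgIdeal.proj_eq_zero_iff, ← hgμ,
        MonoidAlgebra.single_add_erase]
      exact hg
    rw [proj_eq]
    refine Submodule.neg_mem _ (proj_mem_of_forall_monomial_mem _ fun ρ hρ => ?_)
    rw [MonoidAlgebra.coeff_erase, Finsupp.support_erase, Finset.mem_erase] at hρ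
    obtain ⟨hlt, hwt⟩ := hlow ρ hρ.2 hρ.1
    exact ih ρ hlt (hwt.trans hμ)

end UpperBound

variable {S : Set (BC k X)}

theorem exists_finrank_monomialSpan_le [Fintype X] (hord : IsMonomialOrder X) (hS : S.Finite)
    (hmonic : ∀ s ∈ S, IsMonic s) : ∃ C ≠ 0, ∀ n,
      Module.finrank k (monomialSpan (AlgIdeal.span k S) {μ | μ.length ≤ n}) ≤
        Fintype.card X + growth (NF.exponent '' standardPairs (leadPairs S)) (C * n) := by
  obtain ⟨w, hw1, hw⟩ := exists_isLeadingWeight hord hS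
  obtain ⟨C, hC⟩ := (Set.finite_range w).bddAbove
  have length_le_weight : ∀ μ : NF X, μ.length ≤ μ.weight w := fun μ => by
    simpa [NF.weight_const] using μ.weight_mono (show (fun _ => 1) ≤ w from hw1)
  have weight_le : ∀ μ : NF X, μ.weight w ≤ (C + 1) * μ.length := fun μ => by
    rw [← NF.weight_const]
    exact μ.weight_mono fun i => (hC ⟨i, rfl⟩).trans C.le_succ
  refine ⟨C + 1, C.succ_ne_zero, fun n => ?_⟩
  set T : Set (NF X) := {μ ∈ standardPairs (leadPairs S) | μ.length ≤ (C + 1) * n}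
  have hfin : (Set.range (NF.letter : X → NF X) ∪ T).Finite :=
    (Set.finite_range _).union ((NF.finite_length_le _).subset fun μ hμ => hμ.2)
  have hle : monomialSpan (AlgIdeal.span k S) {μ | μ.length ≤ n} ≤
      monomialSpan (AlgIdeal.span k S) (Set.range NF.letter ∪ T) := by
    refine (monomialSpan_le _).2 fun μ hμ => ?_
    refine (monomialSpan_le _).2 (fun ν hν => monomial_mem_monomialSpan _ ?_)
      (hw.monomial_mem hord hmonic ((weight_le μ).trans (Nat.mul_le_mul_left _ hμ)))
    exact hν.imp_right fun h => ⟨h.1, (length_le_weight ν).trans h.2⟩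
  have := finiteDimensional_monomialSpan (AlgIdeal.span k S) hfin
  calc _ ≤ (Set.range (NF.letter : X → NF X) ∪ T).ncard :=
        (Submodule.finrank_mono hle).trans (finrank_monomialSpan_le _ hfin)
    _ ≤ (Set.range (NF.letter : X → NF X)).ncard + T.ncard := Set.ncard_union_le _ _
    _ ≤ _ := by
        rw [NF.growth_exponent_image fun μ hμ => hμ.1, ← Set.image_univ]
        gcongr
        exact (Set.ncard_image_le Set.finite_univ).trans_eq
          ((Set.ncard_univ X).trans Nat.card_eq_fintype_card)

theorem IsGSBasis.gkDim_eq_coneDim [Finite X] (hord : IsMonomialOrder X) (hS : IsGSBasis S)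
    (hfin : S.Finite) :
    gkDim k (BCQuot S) = coneDim (NF.exponent '' standardPairs (leadPairs S)) := by
  have := Fintype.ofFinite X
  set P := NF.exponent '' standardPairs (leadPairs S)
  have hF := isGeneratingFiltration_length (AlgIdeal.span k S)
  apply le_antisymm
  · obtain ⟨C, hC, hle⟩ := exists_finrank_monomialSpan_le hord hfin hS.monic
    obtain ⟨K, hP⟩ := exists_isTruncationInvariant_standardPairs (finite_leadPairs hfin)
    have const_isBigO : (fun _ => (Fintype.card X : ℝ)) =O[atTop]
        fun n : ℕ => (n : ℝ) ^ coneDim P :=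
      .of_bound (Fintype.card X) <| (eventually_ge_atTop 1).mono fun n hn => by
        rw [Real.norm_natCast, norm_pow, Real.norm_natCast]
        exact_mod_cast Nat.le_mul_of_pos_right _ (pow_pos hn _)
    refine hF.gkDim_le (.trans (.of_bound' (.of_forall fun n => ?_))
      (const_isBigO.add (isBigO_pow_comp_mul hP.growth_isBigO hC)))
    rw [Real.norm_natCast, ← Nat.cast_add, Real.norm_natCast]
    exact_mod_cast hle n
  · rcases P.eq_empty_or_nonempty with hP | hP
    · rw [hP, coneDim_empty, Nat.cast_zero]
      exact gkDim_nonneg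
    · refine hF.le_gkDim ((pow_coneDim_isBigO_growth hP).trans (.of_norm_le fun n => ?_))
      rw [Real.norm_natCast, Nat.cast_le, NF.growth_exponent_image fun μ hμ => hμ.1]
      exact hS.ncard_le_finrank hord (NF.finite_length_le n)

end Dimension

/-! ### Bounds for the number of free directions -/

section Bounds

variable {X : Type*} [Fintype X] {L : Set (NF X)}

theorem coneDim_standardPairs_lt (hL : L.Nonempty) :
    coneDim (NF.exponent '' standardPairs L) < 2 * Fintype.card X := by
  obtain ⟨ν, hν⟩ := hL
  rw [two_mul, ← Fintype.card_sum]
  rcases (NF.exponent '' standardPairs L).eq_empty_or_nonempty with hP | hP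
  · rw [hP, coneDim_empty]
    cases ν with
    | letter x => exact Fintype.card_pos_iff.2 ⟨.inl x⟩
    | pair u v hu hv =>
      obtain ⟨x, -⟩ := Multiset.exists_mem_of_ne_zero hu
      exact Fintype.card_pos_iff.2 ⟨.inl x⟩
  · obtain ⟨T, c, hTc, hT⟩ := exists_coordCone_subset_card_eq_coneDim hP
    rw [← hT]
    refine (Finset.card_le_univ T).lt_of_ne fun hcard => ?_
    rw [Finset.card_eq_iff_eq_univ] at hcard
    have sup_mem : c ⊔ ν.exponent ∈ coordCone T c :=
      ⟨le_sup_left, fun i hi => (hi (hcard ▸ Finset.mem_univ i)).elim⟩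
    exact (mem_exponent_image_standardPairs.1 (hTc sup_mem)).2 ν hν le_sup_right

theorem le_coneDim_standardPairs_add_card {Z : Finset (X ⊕ X)} (hl : ∃ x, .inl x ∉ Z)
    (hr : ∃ y, .inr y ∉ Z) (hZ : ∀ ν ∈ L, ∃ i ∈ Z, ν.exponent i ≠ 0) :
    2 * Fintype.card X ≤ coneDim (NF.exponent '' standardPairs L) + Z.card := by
  classical
  have hcone : coordCone Zᶜ (fun i => if i ∈ Z then 0 else 1) ⊆
      NF.exponent '' standardPairs L := by
    rintro d ⟨hcd, hdZ⟩
    have ne_zero_of_notMem : ∀ i ∉ Z, d i ≠ 0 := fun i hi => by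
      have : 1 ≤ d i := (if_neg hi).ge.trans (hcd i)
      exact Nat.one_le_iff_ne_zero.1 this
    refine mem_exponent_image_standardPairs.2 ⟨⟨hl.imp fun x hx => ne_zero_of_notMem _ hx,
      hr.imp fun y hy => ne_zero_of_notMem _ hy⟩, fun ν hν hle => ?_⟩
    obtain ⟨i, hi, hνi⟩ := hZ ν hν
    have : d i = 0 := (hdZ i (Finset.notMem_compl.2 hi)).trans (if_pos hi)
    exact hνi (Nat.le_zero.1 (this ▸ hle i))
  rw [two_mul, ← Fintype.card_sum, ← Finset.card_compl_add_card Z]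
  exact Nat.add_le_add_right (card_le_coneDim hcone) _

theorem le_coneDim_standardPairs_add_ncard (hX : 1 < Fintype.card X) (hL : ∀ μ ∈ L, μ.IsPair)
    (hfin : L.Finite) (hne : L.Nonempty) (hcard : L.ncard ≤ Fintype.card X) :
    2 * Fintype.card X ≤ coneDim (NF.exponent '' standardPairs L) + L.ncard := by
  classical
  lift L to Finset (NF X) using hfin
  rw [Set.ncard_coe_finset] at hcard ⊢
  have exponent_ne_zero : ∀ μ ∈ L, (∃ x, μ.exponent (.inl x) ≠ 0) ∧ ∃ y, μ.exponent (.inr y) ≠ 0 :=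
    fun μ hμ => NF.exists_isPair_exponent_eq_iff.1 ⟨μ, hL μ hμ, rfl⟩
  obtain ⟨μ₀, hμ₀⟩ := hne
  obtain ⟨y₀, hy₀⟩ := (exponent_ne_zero μ₀ hμ₀).2
  have : Nonempty X := ⟨y₀⟩
  choose! x hx using fun μ hμ => (exponent_ne_zero μ hμ).1
  -- One letter is killed on the right, so that fewer than `card X` are killed on the left.
  set A := (L.erase μ₀).image x
  have card_A : A.card + 1 ≤ L.card := by
    rw [← Finset.card_erase_add_one hμ₀]
    exact Nat.add_le_add_right Finset.card_image_le 1
  set Z : Finset (X ⊕ X) := insert (.inr y₀) (A.map .inl)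
  have card_Z : Z.card ≤ L.card :=
    (Finset.card_insert_le _ _).trans (by rwa [Finset.card_map])
  have exists_inl : ∃ z, .inl z ∉ Z := by
    obtain ⟨z, hz⟩ : ∃ z, z ∉ A := by
      by_contra! h
      have := Finset.card_eq_iff_eq_univ A |>.2 (Finset.eq_univ_of_forall h)
      lia
    exact ⟨z, by simpa [Z] using hz⟩
  have exists_inr : ∃ z, .inr z ∉ Z :=
    (Fintype.exists_ne_of_one_lt_card hX y₀).imp fun z hz => by simpa [Z] using hz
  refine (le_coneDim_standardPairs_add_card exists_inl exists_inr fun ν hν => ?_).trans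
    (Nat.add_le_add_left card_Z _)
  obtain rfl | hne := eq_or_ne ν μ₀
  · exact ⟨.inr y₀, Finset.mem_insert_self _ _, hy₀⟩
  · refine ⟨.inl (x ν), Finset.mem_insert_of_mem ?_, hx ν hν⟩
    exact Finset.mem_map_of_mem _ (Finset.mem_image_of_mem x (Finset.mem_erase.2 ⟨hne, hν⟩))

end Bounds

end Bicomm

end

theorem mainTheorem7 {k X : Type*} [Field k] [Fintype X] [LinearOrder (Bicomm.NF X)]
    (hord : Bicomm.IsMonomialOrder X) (hX : 1 < Fintype.card X)
    (S : Finset (Bicomm.BC k X)) (hS : Bicomm.IsGSBasis (S : Set (Bicomm.BC k X))) :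
    (1 ≤ S.card → S.card ≤ Fintype.card X →
      (∀ s ∈ S, ∀ x : X, Bicomm.leadMon s ≠ (Bicomm.NF.letter x : WithBot (Bicomm.NF X))) →
      ∃ m : ℕ, m ∈ Finset.Icc (2 * Fintype.card X - S.card) (2 * Fintype.card X - 1) ∧
        Bicomm.gkDim k (Bicomm.BCQuot (S : Set (Bicomm.BC k X))) = (m : EReal)) ∧
    (Fintype.card X < S.card →
      ∃ m : ℕ, m ∈ Finset.Icc 0 (2 * Fintype.card X - 1) ∧
        Bicomm.gkDim k (Bicomm.BCQuot (S : Set (Bicomm.BC k X))) = (m : EReal)) := by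
  have : Nonempty X := Fintype.card_pos_iff.1 (Nat.zero_lt_of_lt hX)
  set L := Bicomm.leadPairs (S : Set (Bicomm.BC k X))
  have dim_eq := hS.gkDim_eq_coneDim hord S.finite_toSet
  have L_nonempty (h : 0 < S.card) : L.Nonempty :=
    hS.leadPairs_nonempty hord (Finset.card_pos.1 h)
  have dim_lt (h : 0 < S.card) := Bicomm.coneDim_standardPairs_lt (L_nonempty h)
  have L_card : L.ncard ≤ S.card :=
    (Bicomm.ncard_leadPairs_le S.finite_toSet).trans_eq (Set.ncard_coe_finset S)
  refine ⟨fun h1 hr _ => ⟨_, Finset.mem_Icc.2 ⟨?_, Nat.le_sub_one_of_lt (dim_lt h1)⟩, dim_eq⟩,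
    fun hr => ⟨_, Finset.mem_Icc.2 ⟨zero_le, Nat.le_sub_one_of_lt (dim_lt ?_)⟩, dim_eq⟩⟩
  · exact (Nat.sub_le_sub_left L_card _).trans <| Nat.sub_le_iff_le_add.2 <|
      Bicomm.le_coneDim_standardPairs_add_ncard hX (fun _ hμ => hμ.1)
        (Bicomm.finite_leadPairs S.finite_toSet) (L_nonempty h1) (L_card.trans hr)
  · exact Nat.zero_lt_of_lt hr
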